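/- **Setting.** Fix pairwise disjoint sets $N_C,N_R,N_I,N_V$ of concept names, role names, individual names and provenance variables. A *monomial* is a nonempty finite product of elements of $N_V$, modulo associativity and commutativity; $N_M$ is the set of monomials. An *annotated ontology* $\mathcal O$ is a finite set of pairs $(\alpha,v)$, where $v\in N_M$ and $\alpha$ is a DL-Lite$_{\mathcal R}$ inclusion $S\sqsubseteq T$ or $B\sqsubseteq C$, with $S::=R\mid R^-$, $T::=S\mid\neg S$, $B::=A\mid\exists S$, $C::=B\mid\neg B$. A *schema* $\mathcal S$ is a finite set of predicate symbols with arities. A *data instance* $\mathcal D$ over $\mathcal S$ assigns to each $P\in\mathcal S$ of arity $k$ a finite subset $P^{\mathcal D}$ of $N_I^k\times N_V$. A *mapping* $\mathcal M$ is a finite set of annotated rules $(E(\vec x)\leftarrow\varphi(\vec x,\vec y,\vec z),\,m)$, where $m\in N_V$, $E\in N_C\cup N_R$, and $\varphi$ is a conjunction of atoms $P(\vec t,z)$ with $P\in\mathcal S$, $\vec t$ a tuple of variables from $\vec x\cup\vec y$ and $z\in\vec z$. $\mathcal M(\mathcal D)$ is the set of annotated assertions $(E(\mu(\vec x)),\,m\otimes\prod_{z\in\vec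 z}\mu(z))$ for such a rule in $\mathcal M$ and a $\mu$ that maps $\vec x,\vec y$ to $N_I$ and $\vec z$ to $N_V$ with $(\mu(\vec t),\mu(z))\in P^{\mathcal D}$ for every atom $P(\vec t,z)$ of $\varphi$. An *OBDA specification* is a triple $\mathcal P=(\mathcal O,\mathcal M,\mathcal S)$. An *annotated interpretation* $\mathcal I$ has nonempty disjoint domains $\Delta,\Delta_{\sf m}$ and maps $a\in N_I$ to $a^{\mathcal I}\in\Delta$, $p\in N_M$ injectively to $p^{\mathcal I}\in\Delta_{\sf m}$, $A\in N_C$ to $A^{\mathcal I}\subseteq\Delta\times\Delta_{\sf m}$ and $R\in N_R$ to $R^{\mathcal I}\subseteq\Delta\times\Delta\times\Delta_{\sf m}$. Put $(R^-)^{\mathcal I}=\{(e,d,p^{\mathcal I})\mid(d,e,p^{\mathcal I})\in R^{\mathcal I}\}$ and $(\exists S)^{\mathcal I}=\{(d,p^{\mathcal I})\mid\exists e\,(d,e,p^{\mathcal I})\in S^{\mathcal I}\}$, and interpret $\neg$ as complement. $\mathcal I$ satisfies $(B\sqsubseteq C,v)$ if for all $p\in N_M$ and all $d$, $(d,p^{\mathcal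 I})\in B^{\mathcal I}$ implies $(d,(p\otimes v)^{\mathcal I})\in C^{\mathcal I}$, and likewise $(S\sqsubseteq T,v)$ with pairs $d,e$; it satisfies $(A(a),p)$ if $(a^{\mathcal I},p^{\mathcal I})\in A^{\mathcal I}$ and $(R(a,b),p)$ if $(a^{\mathcal I},b^{\mathcal I},p^{\mathcal I})\in R^{\mathcal I}$. It is a model of $(\mathcal P,\mathcal D)$ if it satisfies $\mathcal O$ and $\mathcal M(\mathcal D)$; $(\mathcal P,\mathcal D)$ is *satisfiable* if it has a model. A *BCQ* here is a finite set (conjunction) of atoms $A(t,p)$, $R(s,t,p)$ with $p\in N_M$, where $s,t$ are individual names, existentially quantified variables, or the symbol $\_$, each occurrence of which denotes a separate non-shared existential variable. $\mathcal I\models q$ if there is a match (with $p$ interpreted as $p^{\mathcal I}$), and $(\mathcal P,\mathcal D)\models q$ if all models of $(\mathcal P,\mathcal D)$ satisfy $q$. The algorithm may produce atoms whose last term is the empty product; no interpretation satisfies these. **The algorithm.** An inclusion $(\alpha,v)$ is *applicable* to an atom $g$ with last term $p$ if the monomial $v$ divides $p$ and $\alpha$ and $g$ match the left-hand side of one of the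 following lines, in which $p\ominus v$ is $p$ with the factor $v$ removed once; then $gr(g,(\alpha,v))$ is given by that line: - $gr(A(x,p),(A_1\sqsubseteq A,v))=A_1(x,p\ominus v)$; - $gr(A(x,p),(\exists R\sqsubseteq A,v))=R(x,\_,p\ominus v)$; - $gr(R(x,\_,p),(A\sqsubseteq\exists R,v))=A(x,p\ominus v)$; - $gr(R(x,\_,p),(\exists R_1\sqsubseteq\exists R,v))=R_1(x,\_,p\ominus v)$; - $gr(R(x,y,p),(R_1\sqsubseteq R,v))=R_1(x,y,p\ominus v)$; - $gr(R(x,y,p),(\alpha,v))=R_1(y,x,p\ominus v)$ if $\alpha$ is $R_1\sqsubseteq R^-$ or $R_1^-\sqsubseteq R$. Let $\mathrm{reduce}(q,g_1,g_2)$ be the result of applying to $q$ the most general unifier of $g_1$ and $g_2$ (last terms unify iff they are equal), and let $\tau(q)$ be $q$ with every variable that occurs only once replaced with $\_$. On input $q$ and a set $\mathcal O_{\mathcal T}$ of positive inclusions, $\mathsf{PerfectRef}$ starts with $PR:=\{q\}$ and repeats the following pass until $PR$ does not change any more: for all $q'\in PR$ (as at the start of the pass), all $g,g_1,g_2\in q'$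 and all $I\in\mathcal O_{\mathcal T}$, add to $PR$ the query obtained from $q'$ by replacing $g$ with $gr(g,I)$ if $I$ is applicable to $g$, and add $\tau(\mathrm{reduce}(q',g_1,g_2))$ if $g_1$ and $g_2$ unify. It outputs $PR$. **Theorem.** Let $q$ be a BCQ (with monomials as last terms), let $\mathcal P=(\mathcal O,\mathcal M,\mathcal S)$ be an OBDA specification in which inverse roles occur in positive inclusions at most in the forms $R_1\sqsubseteq R^-$ and $R_1^-\sqsubseteq R$ with $R,R_1\in N_R$, and let $\mathcal O_{\mathcal T}$ be the set of positive inclusions (those without negation) of $\mathcal O$. Then $\mathsf{PerfectRef}$ terminates on $q$ and $\mathcal O_{\mathcal T}$ and outputs a finite set $PR$ of BCQs such that, for all data instances $\mathcal D$ over $\mathcal S$ for which $(\mathcal P,\mathcal D)$ is satisfiable, $$(\mathcal P,\mathcal D)\models q\quad\Longleftrightarrow\quad\text{there is } q^\ddagger\in PR\text{ with }((\emptyset,\mathcal M,\mathcal S),\mathcal D)\models q^\ddagger .$$ -/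

import Mathlib

namespace ProvOBDA

/-! Monomials of the provenance semiring -/

/-- Monomials: nonempty finite products of provenance variables, modulo associativity and
commutativity of the product. -/
def Mono (NV : Type) : Type := {p : Multiset NV // p ≠ 0}

/-- The product of two monomials. -/
def Mono.mul {NV : Type} (p q : Mono NV) : Mono NV :=
  ⟨p.1 + q.1, fun h => p.2 (Multiset.le_zero.mp ((Multiset.le_add_right p.1 q.1).trans_eq h))⟩

instance {NV : Type} [DecidableEq NV] : DecidableEq (Mono NV) :=
  inferInstanceAs (DecidableEq {p : Multiset NV // p ≠ 0})

/-! Annotated ontologies -/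

/-- Role expressions `S ::= R | R⁻`. -/
inductive Role (NR : Type) : Type
  | name (R : NR)
  | inv (R : NR)
  deriving DecidableEq

/-- General role expressions `T ::= S | ¬S`. -/
inductive GenRole (NR : Type) : Type
  | pos (S : Role NR)
  | neg (S : Role NR)
  deriving DecidableEq

/-- Basic concept expressions `B ::= A | ∃S`. -/
inductive Concept (NC NR : Type) : Type
  | name (A : NC)
  | ex (S : Role NR)
  deriving DecidableEq

/-- General concept expressions `C ::= B | ¬B`. -/
inductive GenConcept (NC NR : Type) : Type
  | pos (B : Concept NC NR)
  | neg (B : Concept NC NR)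
  deriving DecidableEq

/-- Role inclusions `S ⊑ T` and concept inclusions `B ⊑ C`. -/
inductive Inclusion (NC NR : Type) : Type
  | role (S : Role NR) (T : GenRole NR)
  | concept (B : Concept NC NR) (C : GenConcept NC NR)
  deriving DecidableEq

/-- Inclusions without negation. -/
def Inclusion.isPositive {NC NR : Type} : Inclusion NC NR → Bool
  | .role _ (.pos _) => true
  | .role _ (.neg _) => false
  | .concept _ (.pos _) => true
  | .concept _ (.neg _) => false

/-- No inverse role in a basic concept. -/
def Concept.InverseFree {NC NR : Type} : Concept NC NR → Prop
  | .name _ => True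
  | .ex (.name _) => True
  | .ex (.inv _) => False

/-- The positive inclusions in which inverse roles occur at most in the forms
`R₁ ⊑ R⁻` and `R₁⁻ ⊑ R`; negative inclusions are not restricted. -/
def Inclusion.InverseNormal {NC NR : Type} : Inclusion NC NR → Prop
  | .role (.inv _) (.pos (.inv _)) => False
  | .role _ _ => True
  | .concept B (.pos C) => B.InverseFree ∧ C.InverseFree
  | .concept _ (.neg _) => True

/-- An inclusion annotated with a monomial. -/
abbrev AnnInclusion (NC NR NV : Type) : Type := Inclusion NC NR × Mono NV

/-- An annotated ontology. -/
abbrev Ontology (NC NR NV : Type) : Type := Finset (AnnInclusion NC NR NV)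

/-- The set of positive inclusions of an ontology. -/
def Ontology.positive {NC NR NV : Type} (O : Ontology NC NR NV) : Ontology NC NR NV :=
  Finset.filter (fun I => I.1.isPositive = true) O

/-! Schemas, data instances, mappings, specifications -/

/-- A data source schema: finitely many predicate symbols with arities. -/
structure Schema : Type 1 where
  Pred : Type
  finite : Finite Pred
  ar : Pred → ℕ

/-- An annotated data instance over a schema. -/
def DataInstance (NI NV : Type) (S : Schema) : Type :=
  (P : S.Pred) → Finset ((Fin (S.ar P) → NI) × NV)

/-- An atom `P(t₁, …, tₖ, z)` of a rule body. The variables for individuals (`args`) and those for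
provenance variables (`ann`) are two separate sorts. -/
structure SourceAtom (S : Schema) : Type where
  pred : S.Pred
  args : Fin (S.ar pred) → ℕ
  ann : ℕ

/-- The head `A(x)` or `R(x, y)` of a rule. -/
inductive RuleHead (NC NR : Type) : Type
  | concept (A : NC) (x : ℕ)
  | role (R : NR) (x y : ℕ)

/-- An annotated GAV rule. -/
structure AnnRule (NC NR NV : Type) (S : Schema) : Type where
  head : RuleHead NC NR
  body : List (SourceAtom S)
  label : NV

/-- The set of variables in the last positions of the body atoms. -/
def AnnRule.annVars {NC NR NV : Type} {S : Schema} (r : AnnRule NC NR NV S) : Finset ℕ :=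
  (r.body.map SourceAtom.ann).toFinset

/-- An annotated OBDA specification `(O, M, S)`. -/
structure Spec (NC NR NV : Type) : Type 1 where
  ontology : Ontology NC NR NV
  schema : Schema
  mapping : Finset (AnnRule NC NR NV schema)

/-- The specification `(∅, M, S)`. -/
def Spec.withoutOntology {NC NR NV : Type} (P : Spec NC NR NV) : Spec NC NR NV :=
  { P with ontology := ∅ }

/-- An annotated assertion `(A(a), p)` or `(R(a, b), p)`. -/
inductive Assertion (NC NR NI NV : Type) : Type
  | concept (A : NC) (a : NI) (p : Mono NV)
  | role (R : NR) (a b : NI) (p : Mono NV)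

/-- The head instantiated by `μ`, annotated with `p`. -/
def RuleHead.instantiate {NC NR NI NV : Type} (μ : ℕ → NI) (p : Mono NV) :
    RuleHead NC NR → Assertion NC NR NI NV
  | .concept A x => .concept A (μ x) p
  | .role R x y => .role R (μ x) (μ y) p

/-- The virtual annotated assertions `M(D)`: the instance of the head of a rule under `(μ, ν)` is
annotated with the label of the rule times the product of `ν z`, over the variables `z` in the last
positions of the body. -/
def virtualAssertions {NC NR NI NV : Type} {S : Schema} (M : Finset (AnnRule NC NR NV S))
    (D : DataInstance NI NV S) : Set (Assertion NC NR NI NV) :=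
  {α | ∃ r ∈ M, ∃ (μ : ℕ → NI) (ν : ℕ → NV),
    (∀ g ∈ r.body, ((fun i => μ (g.args i)), ν g.ann) ∈ D g.pred) ∧
    α = r.head.instantiate μ ⟨r.label ::ₘ r.annVars.val.map ν, Multiset.cons_ne_zero⟩}

/-! Annotated interpretations -/

/-- An annotated interpretation. The two domains are distinct types, hence disjoint. -/
structure Interp (NC NR NI NV : Type) : Type 1 where
  Dom : Type
  MDom : Type
  dom_nonempty : Nonempty Dom
  mdom_nonempty : Nonempty MDom
  ind : NI → Dom
  mono : Mono NV → MDom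
  mono_injective : Function.Injective mono
  concept : NC → Set (Dom × MDom)
  role : NR → Set (Dom × Dom × MDom)

variable {NC NR NI NV : Type}

/-- Extension of a role expression. -/
def Interp.roleExt (J : Interp NC NR NI NV) : Role NR → Set (J.Dom × J.Dom × J.MDom)
  | .name R => J.role R
  | .inv R => {t | ∃ d e p, t = (e, d, J.mono p) ∧ (d, e, J.mono p) ∈ J.role R}

/-- Extension of a general role expression. -/
def Interp.genRoleExt (J : Interp NC NR NI NV) : GenRole NR → Set (J.Dom × J.Dom × J.MDom)
  | .pos S => J.roleExt S
  | .neg S => (J.roleExt S)ᶜ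

/-- Extension of a basic concept expression. -/
def Interp.conceptExt (J : Interp NC NR NI NV) : Concept NC NR → Set (J.Dom × J.MDom)
  | .name A => J.concept A
  | .ex S => {t | ∃ d p, t = (d, J.mono p) ∧ ∃ e, (d, e, J.mono p) ∈ J.roleExt S}

/-- Extension of a general concept expression. -/
def Interp.genConceptExt (J : Interp NC NR NI NV) : GenConcept NC NR → Set (J.Dom × J.MDom)
  | .pos B => J.conceptExt B
  | .neg B => (J.conceptExt B)ᶜ

/-- Satisfaction of an annotated inclusion. -/
def Interp.SatInclusion (J : Interp NC NR NI NV) : AnnInclusion NC NR NV → Prop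
  | (.role S T, p) => ∀ (q : Mono NV) (d e : J.Dom),
      (d, e, J.mono q) ∈ J.roleExt S → (d, e, J.mono (q.mul p)) ∈ J.genRoleExt T
  | (.concept B C, p) => ∀ (q : Mono NV) (d : J.Dom),
      (d, J.mono q) ∈ J.conceptExt B → (d, J.mono (q.mul p)) ∈ J.genConceptExt C

/-- Satisfaction of an annotated assertion. -/
def Interp.SatAssertion (J : Interp NC NR NI NV) : Assertion NC NR NI NV → Prop
  | .concept A a p => (J.ind a, J.mono p) ∈ J.concept A
  | .role R a b p => (J.ind a, J.ind b, J.mono p) ∈ J.role R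

/-- Satisfaction of an annotated OBDA instance `(P, D)`. -/
def Interp.SatInstance (J : Interp NC NR NI NV) (P : Spec NC NR NV)
    (D : DataInstance NI NV P.schema) : Prop :=
  (∀ I ∈ P.ontology, J.SatInclusion I) ∧
    ∀ α ∈ virtualAssertions P.mapping D, J.SatAssertion α

/-- `(P, D)` is satisfiable. -/
def Spec.Satisfiable (P : Spec NC NR NV) (D : DataInstance NI NV P.schema) : Prop :=
  ∃ J : Interp NC NR NI NV, J.SatInstance P D

/-! Boolean conjunctive queries -/

/-- Terms in non-last positions: individual names, variables, and the symbol `_`, every occurrence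
of which stands for a separate variable that occurs nowhere else. -/
inductive QTerm (NI : Type) : Type
  | const (a : NI)
  | var (x : ℕ)
  | blank
  deriving DecidableEq

/-- Query atoms `A(t, p)` and `R(s, t, p)`, whose last term is a product of provenance variables.
In a query given by a user this is a monomial, so `p ≠ 0`; the rewriting can produce the empty
product `0`. -/
inductive QAtom (NC NR NI NV : Type) : Type
  | concept (A : NC) (t : QTerm NI) (p : Multiset NV)
  | role (R : NR) (s t : QTerm NI) (p : Multiset NV)
  deriving DecidableEq

/-- The last term of an atom. -/
def QAtom.ann : QAtom NC NR NI NV → Multiset NV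
  | .concept _ _ p => p
  | .role _ _ _ p => p

/-- A Boolean conjunctive query: a conjunction of non-repeating atoms, with all variables
existentially quantified, and with products of provenance variables as last terms. -/
abbrev BCQ (NC NR NI NV : Type) : Type := Finset (QAtom NC NR NI NV)

/-- `d` is a possible value of the term `t` under the assignment `π` of the variables. -/
def Interp.Value (J : Interp NC NR NI NV) (π : ℕ → J.Dom) : QTerm NI → J.Dom → Prop
  | .const a, d => d = J.ind a
  | .var x, d => d = π x
  | .blank, _ => True

/-- Satisfaction of an atom under an assignment. The empty product is not a monomial, it has no
value in `J`, and an atom with this last term is not satisfied. -/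
def Interp.SatAtom (J : Interp NC NR NI NV) (π : ℕ → J.Dom) : QAtom NC NR NI NV → Prop
  | .concept A t p => ∃ d, J.Value π t d ∧ ∃ hp : p ≠ 0, (d, J.mono ⟨p, hp⟩) ∈ J.concept A
  | .role R s t p => ∃ d e, J.Value π s d ∧ J.Value π t e ∧
      ∃ hp : p ≠ 0, (d, e, J.mono ⟨p, hp⟩) ∈ J.role R

/-- `J` satisfies the query `q`: there is a match of `q` in `J`. -/
def Interp.SatQuery (J : Interp NC NR NI NV) (q : BCQ NC NR NI NV) : Prop :=
  ∃ π : ℕ → J.Dom, ∀ g ∈ q, J.SatAtom π g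

/-- `(P, D)` entails the query `q`. -/
def Spec.Entails (P : Spec NC NR NV) (D : DataInstance NI NV P.schema)
    (q : BCQ NC NR NI NV) : Prop :=
  ∀ J : Interp NC NR NI NV, J.SatInstance P D → J.SatQuery q

/-! The algorithm -/

/-- Substitution of terms for variables; `_` is not affected. -/
def QTerm.subst (σ : ℕ → QTerm NI) : QTerm NI → QTerm NI
  | .const a => .const a
  | .var x => σ x
  | .blank => .blank

/-- Substitution in an atom. -/
def QAtom.subst (σ : ℕ → QTerm NI) : QAtom NC NR NI NV → QAtom NC NR NI NV
  | .concept A t p => .concept A (t.subst σ) p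
  | .role R s t p => .role R (s.subst σ) (t.subst σ) p

/-- Number of occurrences of the variable `x` in a term. -/
def QTerm.occ (x : ℕ) : QTerm NI → ℕ
  | .const _ => 0
  | .var y => if y = x then 1 else 0
  | .blank => 0

/-- Number of occurrences of the variable `x` in an atom. -/
def QAtom.occ (x : ℕ) : QAtom NC NR NI NV → ℕ
  | .concept _ t _ => t.occ x
  | .role _ s t _ => s.occ x + t.occ x

/-- Most general unifier of two terms, as far as the named variables are concerned. Since every `_`
is a variable of its own, it unifies with every term and leaves the named variables unchanged. -/
def QTerm.mgu [DecidableEq NI] : QTerm NI → QTerm NI → Option (ℕ → QTerm NI)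
  | .blank, _ => some .var
  | _, .blank => some .var
  | .var x, t => some (fun z => if z = x then t else .var z)
  | .const a, .var y => some (fun z => if z = y then .const a else .var z)
  | .const a, .const b => if a = b then some .var else none

/-- The common instance of two unified terms: `_` is replaced with the other term. -/
def QTerm.merge : QTerm NI → QTerm NI → QTerm NI
  | .blank, t => t
  | s, _ => s

/-- The common instance of two unified atoms. -/
def QAtom.merge : QAtom NC NR NI NV → QAtom NC NR NI NV → QAtom NC NR NI NV
  | .concept A t p, .concept _ t' _ => .concept A (t.merge t') p
  | .role R s t p, .role _ s' t' _ => .role R (s.merge s') (t.merge t') p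
  | g, _ => g

section
variable [DecidableEq NC] [DecidableEq NR] [DecidableEq NI] [DecidableEq NV]

/-- Most general unifier of two atoms, with the positions unified from left to right. Last terms
unify if they are mathematically equal. -/
def QAtom.mgu : QAtom NC NR NI NV → QAtom NC NR NI NV → Option (ℕ → QTerm NI)
  | .concept A t p, .concept A' t' p' => if A = A' ∧ p = p' then t.mgu t' else none
  | .role R s t p, .role R' s' t' p' =>
      if R = R' ∧ p = p' then
        (s.mgu s').bind fun σ =>
          ((t.subst σ).mgu (t'.subst σ)).map fun ρ => fun z => (σ z).subst ρ
      else none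
  | .concept _ _ _, .role _ _ _ _ => none
  | .role _ _ _ _, .concept _ _ _ => none

/-- `reduce(q, g₁, g₂)`: the most general unifier of `g₁` and `g₂` applied to `q`, if they unify. -/
def reduce (q : BCQ NC NR NI NV) (g₁ g₂ : QAtom NC NR NI NV) : Option (BCQ NC NR NI NV) :=
  (g₁.mgu g₂).map fun σ =>
    insert ((g₁.subst σ).merge (g₂.subst σ)) (((q.erase g₁).erase g₂).image (QAtom.subst σ))

/-- `τ(q)`: every variable with just one occurrence in `q` is replaced with `_`. -/
def tau (q : BCQ NC NR NI NV) : BCQ NC NR NI NV :=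
  q.image (QAtom.subst fun x => if (∑ g ∈ q, g.occ x) ≤ 1 then .blank else .var x)

/-- The atom obtained from `g` by applying an inclusion backwards, with the last term `r`. -/
def QAtom.rewrite (g : QAtom NC NR NI NV) (I : Inclusion NC NR) (r : Multiset NV) :
    Option (QAtom NC NR NI NV) :=
  match g, I with
  | .concept A x _, .concept (.name A₁) (.pos (.name A')) =>
      if A' = A then some (.concept A₁ x r) else none
  | .concept A x _, .concept (.ex (.name R)) (.pos (.name A')) =>
      if A' = A then some (.role R x .blank r) else none
  | .role R x .blank _, .concept (.name A) (.pos (.ex (.name R'))) =>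
      if R' = R then some (.concept A x r) else none
  | .role R x .blank _, .concept (.ex (.name R₁)) (.pos (.ex (.name R'))) =>
      if R' = R then some (.role R₁ x .blank r) else none
  | .role R x y _, .role (.name R₁) (.pos (.name R')) =>
      if R' = R then some (.role R₁ x y r) else none
  | .role R x y _, .role (.name R₁) (.pos (.inv R')) =>
      if R' = R then some (.role R₁ y x r) else none
  | .role R x y _, .role (.inv R₁) (.pos (.name R')) =>
      if R' = R then some (.role R₁ y x r) else none
  | _, _ => none

/-- `gr(g, I)` for `I` annotated with the monomial `v`, which has to occur in (that is, divide) the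
last term of `g` and is removed from it once; the value is `none` if and only if `I` is not applicable to `g`. -/
def gr (g : QAtom NC NR NI NV) (I : AnnInclusion NC NR NV) : Option (QAtom NC NR NI NV) :=
  if I.2.1 ≤ g.ann then g.rewrite I.1 (g.ann - I.2.1) else none

/-- The queries that the body of the loop adds for the query `q`. -/
def newQueries (T : Ontology NC NR NV) (q : BCQ NC NR NI NV) : Finset (BCQ NC NR NI NV) :=
  (q.biUnion fun g => T.biUnion fun I =>
      (gr g I).toFinset.image fun g' => insert g' (q.erase g)) ∪
    q.biUnion fun g₁ => q.biUnion fun g₂ => (reduce q g₁ g₂).toFinset.image tau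

/-- One pass of the loop. -/
def pass (T : Ontology NC NR NV) (PR : Finset (BCQ NC NR NI NV)) : Finset (BCQ NC NR NI NV) :=
  PR ∪ PR.biUnion (newQueries T)

/-- `Loop T PR out`: the loop "repeat `PR' := PR`; pass; until `PR' = PR`", entered with the set
`PR`, terminates and leaves the set `out`. -/
inductive Loop (T : Ontology NC NR NV) :
    Finset (BCQ NC NR NI NV) → Finset (BCQ NC NR NI NV) → Prop
  | finish (PR : Finset (BCQ NC NR NI NV)) : pass T PR = PR → Loop T PR PR
  | next (PR out : Finset (BCQ NC NR NI NV)) :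
      pass T PR ≠ PR → Loop T (pass T PR) out → Loop T PR out

/-- `PerfectRef` terminates on the query `q` and the set `T` of positive inclusions, with the
output `out`. -/
def PerfectRefOutputs (q : BCQ NC NR NI NV) (T : Ontology NC NR NV)
    (out : Finset (BCQ NC NR NI NV)) : Prop :=
  Loop T {q} out

end

end ProvOBDA

namespace ProvOBDA

variable {NC NR NI NV : Type}

/-! Termination: a rewriting step invents no variable, takes new predicates only from left-hand
sides of inclusions, and only removes factors from last terms. All reachable queries thus live in a
finite set (`exists_perfectRefOutputs`).

Soundness: in a model of the positive inclusions, a match of a rewritten query yields a match of the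
query it came from (`Interp.SatQuery.of_newQueries`). This propagates along the loop.

Completeness: if the instance is satisfiable, the chase `canonical`, with a labelled null for every
required successor, is a model (`Spec.Satisfiable.canonical`), so an entailed query has a match π
into derived facts. With π kept fixed, chase steps are undone by rewriting until only assertions of
M(D) are hit. Every round lowers `BCQ.weight`: a backward step divides by a nonempty monomial, and a
reduction merges two atoms that hit the same fact (`BCQ.Matches.exists_smaller`).

The one obstacle is an atom R(s,y) that hits the fact introducing a null, since the existential
rules apply only to R(s,_). Annotations resolve it: every other fact containing that null has an
annotation of strictly larger degree (`Chase.eq_or_card_lt`). If distinct atoms never hit a common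
fact and an atom of maximal degree not yet matching an assertion is picked, y occurs nowhere else,
and τ turns it into a blank. -/

/-! Termination -/

/-- The symbols of an atom belong to given sets. -/
def QAtom.Within (Cs : Finset NC) (Rs : Finset NR) (Ts : Finset (QTerm NI))
    (Ms : Finset (Multiset NV)) : QAtom NC NR NI NV → Prop
  | .concept A t p => A ∈ Cs ∧ t ∈ Ts ∧ p ∈ Ms
  | .role R s t p => R ∈ Rs ∧ s ∈ Ts ∧ t ∈ Ts ∧ p ∈ Ms

theorem QAtom.finite_within (Cs : Finset NC) (Rs : Finset NR) (Ts : Finset (QTerm NI))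
    (Ms : Finset (Multiset NV)) :
    {g : QAtom NC NR NI NV | g.Within Cs Rs Ts Ms}.Finite := by
  classical
  refine Set.Finite.subset (Finset.finite_toSet
    ((Cs ×ˢ Ts ×ˢ Ms).image (fun x => QAtom.concept x.1 x.2.1 x.2.2) ∪
      (Rs ×ˢ Ts ×ˢ Ts ×ˢ Ms).image (fun x => QAtom.role x.1 x.2.1 x.2.2.1 x.2.2.2))) ?_
  intro g hg
  simp only [Finset.coe_union, Finset.coe_image, Set.mem_union, Set.mem_image]
  cases g with
  | concept A t p =>
    obtain ⟨h₁, h₂, h₃⟩ := hg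
    exact Or.inl ⟨(A, t, p), by simp [h₁, h₂, h₃], rfl⟩
  | role R s t p =>
    obtain ⟨h₁, h₂, h₃, h₄⟩ := hg
    exact Or.inr ⟨(R, s, t, p), by simp [h₁, h₂, h₃, h₄], rfl⟩

theorem QAtom.Within.subst {Cs : Finset NC} {Rs : Finset NR} {Ts : Finset (QTerm NI)}
    {Ms : Finset (Multiset NV)} {g : QAtom NC NR NI NV} (hg : g.Within Cs Rs Ts Ms)
    {σ : ℕ → QTerm NI} (hσ : ∀ t ∈ Ts, t.subst σ ∈ Ts) : (g.subst σ).Within Cs Rs Ts Ms := by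
  cases g with
  | concept A t p => exact ⟨hg.1, hσ _ hg.2.1, hg.2.2⟩
  | role R s t p => exact ⟨hg.1, hσ _ hg.2.1, hσ _ hg.2.2.1, hg.2.2.2⟩

theorem QTerm.merge_eq_or (s t : QTerm NI) : s.merge t = s ∨ s.merge t = t := by
  cases s <;> simp [QTerm.merge]

theorem QTerm.merge_mem {Ts : Finset (QTerm NI)} {s t : QTerm NI} (hs : s ∈ Ts) (ht : t ∈ Ts) :
    s.merge t ∈ Ts := by
  rcases QTerm.merge_eq_or s t with h | h <;> rw [h] <;> assumption

theorem QAtom.Within.merge {Cs : Finset NC} {Rs : Finset NR} {Ts : Finset (QTerm NI)}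
    {Ms : Finset (Multiset NV)} {g g' : QAtom NC NR NI NV} (hg : g.Within Cs Rs Ts Ms)
    (hg' : g'.Within Cs Rs Ts Ms) : (g.merge g').Within Cs Rs Ts Ms := by
  cases g <;> cases g' <;> simp only [QAtom.merge, QAtom.Within] at hg hg' ⊢
  · exact ⟨hg.1, QTerm.merge_mem hg.2.1 hg'.2.1, hg.2.2⟩
  · exact hg
  · exact hg
  · exact ⟨hg.1, QTerm.merge_mem hg.2.1 hg'.2.1, QTerm.merge_mem hg.2.2.1 hg'.2.2.1, hg.2.2.2⟩

/-- Concept names on the left-hand side of an inclusion. -/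
def Inclusion.lhsConcepts : Inclusion NC NR → Finset NC
  | .concept (.name A) _ => {A}
  | _ => ∅

/-- Role names on the left-hand side of an inclusion. -/
def Inclusion.lhsRoles : Inclusion NC NR → Finset NR
  | .concept (.ex (.name R)) _ => {R}
  | .role (.name R) _ => {R}
  | .role (.inv R) _ => {R}
  | _ => ∅

def QAtom.concepts : QAtom NC NR NI NV → Finset NC
  | .concept A _ _ => {A}
  | .role _ _ _ _ => ∅

def QAtom.roles : QAtom NC NR NI NV → Finset NR
  | .concept _ _ _ => ∅
  | .role R _ _ _ => {R}

def QAtom.terms [DecidableEq NI] : QAtom NC NR NI NV → Finset (QTerm NI)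
  | .concept _ t _ => {t}
  | .role _ s t _ => {s, t}

theorem QTerm.subst_var (t : QTerm NI) : t.subst .var = t := by
  cases t <;> rfl

theorem QAtom.subst_var (g : QAtom NC NR NI NV) : g.subst .var = g := by
  cases g <;> simp [QAtom.subst, QTerm.subst_var]

theorem QTerm.subst_subst (σ ρ : ℕ → QTerm NI) (t : QTerm NI) :
    t.subst (fun z => (σ z).subst ρ) = (t.subst σ).subst ρ := by
  cases t <;> rfl

section
variable [DecidableEq NC] [DecidableEq NR] [DecidableEq NI] [DecidableEq NV]

theorem mem_newQueries {T : Ontology NC NR NV} {q q' : BCQ NC NR NI NV} :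
    q' ∈ newQueries T q ↔
      (∃ g ∈ q, ∃ I ∈ T, ∃ g', gr g I = some g' ∧ q' = insert g' (q.erase g)) ∨
      (∃ g₁ ∈ q, ∃ g₂ ∈ q, ∃ r, reduce q g₁ g₂ = some r ∧ q' = tau r) := by
  simp only [newQueries, Finset.mem_union, Finset.mem_biUnion, Finset.mem_image,
    Option.mem_toFinset, Option.mem_def, eq_comm (a := q')]

/-- A unifier changes at most one variable, and sends it to the other term of the pair, so nothing
outside `Ts` can arise. -/
theorem QTerm.mgu_closed {Ts : Finset (QTerm NI)} {s t : QTerm NI} (hs : s ∈ Ts) (ht : t ∈ Ts)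
    {σ : ℕ → QTerm NI} (h : s.mgu t = some σ) : ∀ u ∈ Ts, u.subst σ ∈ Ts := by
  intro u hu
  unfold QTerm.mgu at h
  split at h <;> simp only [Option.some.injEq, Option.ite_none_right_eq_some] at h
  · rwa [← h, QTerm.subst_var]
  · rwa [← h, QTerm.subst_var]
  · subst h
    cases u <;> simp only [QTerm.subst] <;> (try split) <;> assumption
  · subst h
    cases u <;> simp only [QTerm.subst] <;> (try split) <;> assumption
  · rwa [← h.2, QTerm.subst_var]

theorem QAtom.mgu_closed {Cs : Finset NC} {Rs : Finset NR} {Ts : Finset (QTerm NI)}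
    {Ms : Finset (Multiset NV)} {g₁ g₂ : QAtom NC NR NI NV} (h₁ : g₁.Within Cs Rs Ts Ms)
    (h₂ : g₂.Within Cs Rs Ts Ms) {σ : ℕ → QTerm NI} (h : g₁.mgu g₂ = some σ) :
    ∀ u ∈ Ts, u.subst σ ∈ Ts := by
  cases g₁ <;> cases g₂ <;> simp only [QAtom.mgu, Option.ite_none_right_eq_some,
    Option.bind_eq_some_iff, Option.map_eq_some_iff, reduceCtorEq] at h
  · exact QTerm.mgu_closed h₁.2.1 h₂.2.1 h.2
  · obtain ⟨-, σ', hσ', ρ, hρ, rfl⟩ := h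
    have hc := QTerm.mgu_closed h₁.2.1 h₂.2.1 hσ'
    intro u hu
    rw [QTerm.subst_subst]
    exact QTerm.mgu_closed (hc _ h₁.2.2.1) (hc _ h₂.2.2.1) hρ _ (hc _ hu)

omit [DecidableEq NI] in
-- The only new term is a blank and the new annotation is a submultiset of the old one; hence the
-- conditions on `Ts` and `Ms`.
theorem QAtom.Within.gr {Cs : Finset NC} {Rs : Finset NR} {Ts : Finset (QTerm NI)}
    {Ms : Finset (Multiset NV)} {g g' : QAtom NC NR NI NV} {I : AnnInclusion NC NR NV}
    (hb : QTerm.blank ∈ Ts) (hM : ∀ p ∈ Ms, ∀ r ≤ p, r ∈ Ms) (hC : I.1.lhsConcepts ⊆ Cs)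
    (hR : I.1.lhsRoles ⊆ Rs) (hg : g.Within Cs Rs Ts Ms) (h : ProvOBDA.gr g I = some g') :
    g'.Within Cs Rs Ts Ms := by
  obtain ⟨I, v⟩ := I
  simp only [ProvOBDA.gr, Option.ite_none_right_eq_some] at h
  obtain ⟨-, h⟩ := h
  unfold QAtom.rewrite at h
  split at h <;> simp only [Option.ite_none_right_eq_some, Option.some.injEq, reduceCtorEq] at h <;>
    obtain ⟨-, rfl⟩ := h <;>
    simp only [Inclusion.lhsConcepts, Inclusion.lhsRoles, Finset.singleton_subset_iff] at hC hR <;>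
    simp only [QAtom.Within, QAtom.ann] at hg ⊢ <;>
    refine ⟨by assumption, ?_⟩ <;>
    simp only [hg, hb, true_and]
  all_goals first
    | exact hM _ hg.2.2.2 _ tsub_le_self
    | exact hM _ hg.2.2 _ tsub_le_self

theorem within_newQueries {Cs : Finset NC} {Rs : Finset NR} {Ts : Finset (QTerm NI)}
    {Ms : Finset (Multiset NV)} {T : Ontology NC NR NV}
    (hb : QTerm.blank ∈ Ts) (hM : ∀ p ∈ Ms, ∀ r ≤ p, r ∈ Ms)
    (hC : ∀ I ∈ T, I.1.lhsConcepts ⊆ Cs) (hR : ∀ I ∈ T, I.1.lhsRoles ⊆ Rs)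
    {q q' : BCQ NC NR NI NV} (hq : ∀ g ∈ q, g.Within Cs Rs Ts Ms) (h : q' ∈ newQueries T q) :
    ∀ g ∈ q', g.Within Cs Rs Ts Ms := by
  rcases mem_newQueries.mp h with ⟨g, hg, I, hI, g', hg', rfl⟩ | ⟨g₁, h₁, g₂, h₂, r, hr, rfl⟩
  · intro k hk
    rcases Finset.mem_insert.mp hk with rfl | hk
    · exact (hq g hg).gr hb hM (hC I hI) (hR I hI) hg'
    · exact hq k (Finset.mem_of_mem_erase hk)
  · have hr' : ∀ g ∈ r, g.Within Cs Rs Ts Ms := by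
      simp only [reduce, Option.map_eq_some_iff] at hr
      obtain ⟨σ, hσ, rfl⟩ := hr
      have hc := QAtom.mgu_closed (hq _ h₁) (hq _ h₂) hσ
      intro k hk
      rcases Finset.mem_insert.mp hk with rfl | hk
      · exact ((hq _ h₁).subst hc).merge ((hq _ h₂).subst hc)
      · obtain ⟨l, hl, rfl⟩ := Finset.mem_image.mp hk
        exact (hq l (Finset.mem_of_mem_erase (Finset.mem_of_mem_erase hl))).subst hc
    intro k hk
    obtain ⟨l, hl, rfl⟩ := Finset.mem_image.mp hk
    refine (hr' l hl).subst fun t ht => ?_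
    cases t with
    | const a => exact ht
    | blank => exact ht
    | var x =>
      simp only [QTerm.subst]
      split <;> assumption

/-- A pass that changes the set enlarges it inside `U`, so the number of queries of `U` not yet
found drops. -/
theorem exists_loop {T : Ontology NC NR NV} {U : Finset (BCQ NC NR NI NV)}
    (hU : ∀ q ∈ U, newQueries T q ⊆ U) (PR : Finset (BCQ NC NR NI NV)) (hPR : PR ⊆ U) :
    ∃ out, Loop T PR out := by
  induction hn : (U \ PR).card using Nat.strong_induction_on generalizing PR with
  | _ n ih =>
    by_cases hp : pass T PR = PR
    · exact ⟨PR, .finish PR hp⟩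
    · have hsub : PR ⊆ pass T PR := Finset.subset_union_left
      have hpU : pass T PR ⊆ U :=
        Finset.union_subset hPR (Finset.biUnion_subset.mpr fun q hq => hU q (hPR hq))
      have hlt : (U \ pass T PR).card < n := by
        subst hn
        refine Finset.card_lt_card (Finset.ssubset_iff_subset_ne.mpr
          ⟨Finset.sdiff_subset_sdiff subset_rfl hsub, fun he => hp ?_⟩)
        rw [← Finset.sdiff_sdiff_eq_self hpU, he, Finset.sdiff_sdiff_eq_self hPR]
      obtain ⟨out, ho⟩ := ih _ hlt _ hpU rfl
      exact ⟨out, .next PR out hp ho⟩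

theorem exists_perfectRefOutputs (q : BCQ NC NR NI NV) (T : Ontology NC NR NV) :
    ∃ PR, PerfectRefOutputs q T PR := by
  -- These four finite sets bound every symbol that rewriting can reach from `q`.
  let Cs : Finset NC := q.biUnion QAtom.concepts ∪ T.biUnion fun I => I.1.lhsConcepts
  let Rs : Finset NR := q.biUnion QAtom.roles ∪ T.biUnion fun I => I.1.lhsRoles
  let Ts : Finset (QTerm NI) := insert .blank (q.biUnion QAtom.terms)
  let Ms : Finset (Multiset NV) := q.biUnion fun g => g.ann.powerset.toFinset
  have hM : ∀ p ∈ Ms, ∀ r ≤ p, r ∈ Ms := by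
    intro p hp r hr
    simp only [Ms, Finset.mem_biUnion, Multiset.mem_toFinset, Multiset.mem_powerset] at hp ⊢
    obtain ⟨g, hg, hpg⟩ := hp
    exact ⟨g, hg, hr.trans hpg⟩
  have hC : ∀ I ∈ T, I.1.lhsConcepts ⊆ Cs := fun I hI =>
    (Finset.subset_biUnion_of_mem (fun I : AnnInclusion NC NR NV => I.1.lhsConcepts) hI).trans
      Finset.subset_union_right
  have hR : ∀ I ∈ T, I.1.lhsRoles ⊆ Rs := fun I hI =>
    (Finset.subset_biUnion_of_mem (fun I : AnnInclusion NC NR NV => I.1.lhsRoles) hI).trans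
      Finset.subset_union_right
  let W := (QAtom.finite_within Cs Rs Ts Ms).toFinset
  have hW : ∀ g, g ∈ W ↔ g.Within Cs Rs Ts Ms := fun g => Set.Finite.mem_toFinset _
  refine exists_loop (U := W.powerset) (fun q' hq' q'' hq'' => ?_) {q} ?_
  · rw [Finset.mem_powerset] at hq' ⊢
    intro g hg
    exact (hW g).mpr (within_newQueries (Finset.mem_insert_self _ _) hM hC hR
      (fun g hg => (hW g).mp (hq' hg)) hq'' g hg)
  · rw [Finset.singleton_subset_iff, Finset.mem_powerset]
    intro g hg
    rw [hW]
    have hm : g.ann ∈ Ms := Finset.mem_biUnion.mpr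
      ⟨g, hg, Multiset.mem_toFinset.mpr (Multiset.mem_powerset.mpr le_rfl)⟩
    have hc := Finset.subset_biUnion_of_mem QAtom.concepts hg
    have hr := Finset.subset_biUnion_of_mem QAtom.roles hg
    have ht := Finset.subset_biUnion_of_mem QAtom.terms hg
    cases g with
    | concept A t p =>
      exact ⟨Finset.mem_union_left _ (hc (Finset.mem_singleton_self A)),
        Finset.mem_insert_of_mem (ht (Finset.mem_singleton_self t)), hm⟩
    | role R s t p =>
      exact ⟨Finset.mem_union_left _ (hr (Finset.mem_singleton_self R)),
        Finset.mem_insert_of_mem (ht (by simp [QAtom.terms])),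
        Finset.mem_insert_of_mem (ht (by simp [QAtom.terms])), hm⟩

theorem Loop.subset {T : Ontology NC NR NV} {PR out : Finset (BCQ NC NR NI NV)}
    (h : Loop T PR out) : PR ⊆ out := by
  induction h with
  | finish PR h => exact subset_rfl
  | next PR out _ _ ih => exact Finset.subset_union_left.trans ih

/-- The output is a fixed point of `pass`. Together with containing `q`, this is all that
completeness uses about it. -/
theorem Loop.newQueries_subset {T : Ontology NC NR NV} {PR out : Finset (BCQ NC NR NI NV)}
    (h : Loop T PR out) {q : BCQ NC NR NI NV} (hq : q ∈ out) : newQueries T q ⊆ out := by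
  induction h with
  | finish PR h =>
    rw [← h]
    exact (Finset.subset_biUnion_of_mem _ hq).trans Finset.subset_union_right
  | next PR out _ _ ih => exact ih hq

theorem Loop.invariant {T : Ontology NC NR NV} {PR out : Finset (BCQ NC NR NI NV)}
    (h : Loop T PR out) {Φ : BCQ NC NR NI NV → Prop}
    (hΦ : ∀ q, Φ q → ∀ q' ∈ newQueries T q, Φ q') (h₀ : ∀ q ∈ PR, Φ q) : ∀ q ∈ out, Φ q := by
  induction h with
  | finish PR h => exact h₀
  | next PR out _ _ ih =>
    refine ih fun q hq => ?_
    rcases Finset.mem_union.mp hq with hq | hq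
    · exact h₀ q hq
    · obtain ⟨q₀, hq₀, hq⟩ := Finset.mem_biUnion.mp hq
      exact hΦ q₀ (h₀ q₀ hq₀) q hq

end

/-! Soundness -/

theorem Interp.mem_conceptExt_ex {J : Interp NC NR NI NV} {S : Role NR} {d : J.Dom}
    {p : Mono NV} :
    (d, J.mono p) ∈ J.conceptExt (.ex S) ↔ ∃ e, (d, e, J.mono p) ∈ J.roleExt S := by
  constructor
  · rintro ⟨d', p', h, e, he⟩
    simp only [Prod.mk.injEq] at h
    obtain ⟨rfl, h⟩ := h
    rw [h]
    exact ⟨e, he⟩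
  · rintro ⟨e, he⟩
    exact ⟨d, p, rfl, e, he⟩

theorem Interp.mem_roleExt_inv {J : Interp NC NR NI NV} {R : NR} {d e : J.Dom} {p : Mono NV} :
    (d, e, J.mono p) ∈ J.roleExt (.inv R) ↔ (e, d, J.mono p) ∈ J.role R := by
  constructor
  · rintro ⟨d', e', p', h, he⟩
    simp only [Prod.mk.injEq] at h
    obtain ⟨rfl, rfl, h⟩ := h
    exact h ▸ he
  · intro h
    exact ⟨e, d, p, rfl, h⟩

theorem Interp.Value.congr {J : Interp NC NR NI NV} {π π' : ℕ → J.Dom} {t : QTerm NI}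
    {d : J.Dom} (h : J.Value π t d) (hπ : ∀ x, 0 < t.occ x → π' x = π x) : J.Value π' t d := by
  cases t with
  | const a => exact h
  | blank => trivial
  | var x => exact (show d = π x from h).trans (hπ x (by simp [QTerm.occ])).symm

theorem Interp.SatAtom.congr {J : Interp NC NR NI NV} {π π' : ℕ → J.Dom}
    {g : QAtom NC NR NI NV} (h : J.SatAtom π g) (hπ : ∀ x, 0 < g.occ x → π' x = π x) :
    J.SatAtom π' g := by
  cases g with
  | concept A t p =>
    obtain ⟨d, hd, hp⟩ := h
    exact ⟨d, hd.congr hπ, hp⟩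
  | role R s t p =>
    obtain ⟨d, e, hd, he, hp⟩ := h
    exact ⟨d, e, hd.congr fun x hx => hπ x (Nat.add_pos_left hx _),
      he.congr fun x hx => hπ x (Nat.add_pos_right _ hx), hp⟩

theorem Interp.Value.exists_unblank {J : Interp NC NR NI NV} {π : ℕ → J.Dom}
    {θ : ℕ → QTerm NI} (hθ : ∀ x, θ x = .blank ∨ θ x = .var x) {t : QTerm NI} {d : J.Dom}
    (h : J.Value π (t.subst θ) d) :
    ∃ π', J.Value π' t d ∧ ∀ x, ¬(θ x = .blank ∧ 0 < t.occ x) → π' x = π x := by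
  classical
  cases t with
  | const a => exact ⟨π, h, fun _ _ => rfl⟩
  | blank => exact ⟨π, trivial, fun _ _ => rfl⟩
  | var y =>
    rcases hθ y with hy | hy
    · refine ⟨Function.update π y d, by simp [Interp.Value], fun x hx => ?_⟩
      refine Function.update_of_ne ?_ _ _
      rintro rfl
      exact hx ⟨hy, by simp [QTerm.occ]⟩
    · rw [QTerm.subst, hy] at h
      exact ⟨π, h, fun _ _ => rfl⟩

/-- Each position of a role atom gets its own repaired assignment. A blanked variable occurs at most
once in the atom, so the two can be glued. -/
theorem Interp.SatAtom.exists_unblank {J : Interp NC NR NI NV} {π : ℕ → J.Dom}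
    {θ : ℕ → QTerm NI} (hθ : ∀ x, θ x = .blank ∨ θ x = .var x) {g : QAtom NC NR NI NV}
    (hg : ∀ x, θ x = .blank → g.occ x ≤ 1) (h : J.SatAtom π (g.subst θ)) :
    ∃ π', J.SatAtom π' g ∧ ∀ x, θ x ≠ .blank → π' x = π x := by
  cases g with
  | concept A t p =>
    obtain ⟨d, hd, hp⟩ := h
    obtain ⟨π', h₁, h₂⟩ := hd.exists_unblank hθ
    exact ⟨π', ⟨d, h₁, hp⟩, fun x hx => h₂ x fun h => hx h.1⟩
  | role R s t p =>
    obtain ⟨d, e, hd, he, hp⟩ := h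
    obtain ⟨π₁, h₁, h₁'⟩ := hd.exists_unblank hθ
    obtain ⟨π₂, h₂, h₂'⟩ := he.exists_unblank hθ
    classical
    refine ⟨fun x => if θ x = .blank ∧ 0 < s.occ x then π₁ x else π₂ x,
      ⟨d, e, h₁.congr fun x hx => ?_, h₂.congr fun x hx => ?_, hp⟩, fun x hx => ?_⟩
    · by_cases hb : θ x = .blank
      · simp [hb, hx]
      · rw [if_neg (fun h => hb h.1), h₁' x (fun h => hb h.1), h₂' x (fun h => hb h.1)]
    · rw [if_neg]
      rintro ⟨hb, hx'⟩
      have := hg x hb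
      simp only [QAtom.occ] at this
      omega
    · exact (if_neg (fun h => hx h.1)).trans (h₂' x (fun h => hx h.1))

theorem QTerm.subst_ne_blank {s : QTerm NI} {σ : ℕ → QTerm NI} (hσ : ∀ x, σ x ≠ .blank)
    (hs : s ≠ .blank) : s.subst σ ≠ .blank := by
  cases s <;> simp_all [QTerm.subst]

/-- The term that `merge` drops is either a blank, which constrains nothing, or equal to the one
that is kept. -/
theorem Interp.Value.of_merge {J : Interp NC NR NI NV} {π : ℕ → J.Dom} {s t : QTerm NI}
    (h : s = .blank ∨ t = .blank ∨ s = t) {d : J.Dom} (hd : J.Value π (s.merge t) d) :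
    J.Value π s d ∧ J.Value π t d := by
  rcases h with rfl | rfl | rfl
  · exact ⟨trivial, hd⟩
  · cases s <;> exact ⟨hd, trivial⟩
  · cases s <;> exact ⟨hd, hd⟩

theorem QTerm.subst_eq_blank {s : QTerm NI} (σ : ℕ → QTerm NI) (h : s = .blank) :
    s.subst σ = .blank := by
  rw [h]; rfl

theorem Interp.SatAtom.of_subst {J : Interp NC NR NI NV} {π π' : ℕ → J.Dom}
    {σ : ℕ → QTerm NI} (hπ : ∀ x d, J.Value π (σ x) d → d = π' x) {g : QAtom NC NR NI NV}
    (h : J.SatAtom π (g.subst σ)) : J.SatAtom π' g := by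
  have hv : ∀ (t : QTerm NI) d, J.Value π (t.subst σ) d → J.Value π' t d := by
    intro t d hd
    cases t with
    | const a => exact hd
    | blank => trivial
    | var x => exact hπ x d hd
  cases g with
  | concept A t p =>
    obtain ⟨d, hd, hp⟩ := h
    exact ⟨d, hv _ _ hd, hp⟩
  | role R s t p =>
    obtain ⟨d, e, hd, he, hp⟩ := h
    exact ⟨d, e, hv _ _ hd, hv _ _ he, hp⟩

section
variable [DecidableEq NC] [DecidableEq NR] [DecidableEq NI] [DecidableEq NV]

/-- A blanked variable belongs to at most one atom, so the values chosen atom by atom never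
conflict. -/
theorem Interp.SatQuery.of_tau {J : Interp NC NR NI NV} {q : BCQ NC NR NI NV}
    (h : J.SatQuery (tau q)) : J.SatQuery q := by
  classical
  obtain ⟨π, h⟩ := h
  set θ : ℕ → QTerm NI := fun x => if (∑ g ∈ q, g.occ x) ≤ 1 then .blank else .var x with hθd
  have hθ : ∀ x, θ x = .blank ∨ θ x = .var x := fun x => by
    simp only [hθd]; split <;> simp
  have hθb : ∀ x, θ x = .blank → (∑ g ∈ q, g.occ x) ≤ 1 := fun x hx => by
    by_contra hc
    simp [hθd, hc] at hx
  have hex : ∀ g : QAtom NC NR NI NV, ∃ π' : ℕ → J.Dom,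
      g ∈ q → J.SatAtom π' g ∧ ∀ x, θ x ≠ .blank → π' x = π x := by
    intro g
    by_cases hg : g ∈ q
    · obtain ⟨π', h'⟩ := Interp.SatAtom.exists_unblank (g := g) hθ
        (fun x hx => (Finset.single_le_sum (f := fun g : QAtom NC NR NI NV => g.occ x)
          (fun _ _ => Nat.zero_le _) hg).trans (hθb x hx))
        (h _ (Finset.mem_image_of_mem _ hg))
      exact ⟨π', fun _ => h'⟩
    · exact ⟨π, fun h => absurd h hg⟩
  choose ρ hρ using hex
  refine ⟨fun x => if hx : θ x = .blank ∧ ∃ g ∈ q, 0 < g.occ x then ρ hx.2.choose x else π x,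
    fun g hg => (hρ g hg).1.congr fun x hx => ?_⟩
  by_cases hb : θ x = .blank
  · have hc : θ x = .blank ∧ ∃ g ∈ q, 0 < g.occ x := ⟨hb, g, hg, hx⟩
    rw [dif_pos hc]
    have hs := hc.2.choose_spec
    have : hc.2.choose = g := by
      -- Two different atoms containing `x` would give it at least two occurrences.
      by_contra hne
      have hle := Finset.sum_le_sum_of_subset (f := fun g : QAtom NC NR NI NV => g.occ x)
        (Finset.insert_subset hs.1 (Finset.singleton_subset_iff.mpr hg))
      rw [Finset.sum_pair hne] at hle
      have := hθb x hb
      omega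
    rw [this]
  · rw [dif_neg (fun h => hb h.1), (hρ g hg).2 x hb]

/-- Needed so that σ x has a definite value under an assignment, from which a match of the unreduced
query can be defined. -/
theorem QTerm.mgu_ne_blank {s t : QTerm NI} {σ : ℕ → QTerm NI} (h : s.mgu t = some σ) (x : ℕ) :
    σ x ≠ .blank := by
  unfold QTerm.mgu at h
  split at h <;> simp only [Option.some.injEq, Option.ite_none_right_eq_some] at h
  · simp [← h]
  · simp [← h]
  · subst h
    dsimp only
    split
    · assumption
    · simp
  · subst h
    dsimp only
    split <;> simp
  · simp [← h.2]

theorem QTerm.subst_mgu {s t : QTerm NI} {σ : ℕ → QTerm NI} (h : s.mgu t = some σ) :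
    s = .blank ∨ t = .blank ∨ s.subst σ = t.subst σ := by
  unfold QTerm.mgu at h
  split at h <;> simp only [Option.some.injEq, Option.ite_none_right_eq_some] at h
  · exact Or.inl rfl
  · exact Or.inr (Or.inl rfl)
  · subst h
    refine Or.inr (Or.inr ?_)
    cases t <;> simp [QTerm.subst]
  · subst h
    simp [QTerm.subst]
  · rw [h.1]
    simp

theorem QAtom.mgu_ne_blank {g₁ g₂ : QAtom NC NR NI NV} {σ : ℕ → QTerm NI}
    (h : g₁.mgu g₂ = some σ) (x : ℕ) : σ x ≠ .blank := by
  cases g₁ <;> cases g₂ <;> simp only [QAtom.mgu, Option.ite_none_right_eq_some,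
    Option.bind_eq_some_iff, Option.map_eq_some_iff, reduceCtorEq] at h
  · exact QTerm.mgu_ne_blank h.2 x
  · obtain ⟨-, σ', hσ', ρ, hρ, rfl⟩ := h
    exact QTerm.subst_ne_blank (QTerm.mgu_ne_blank hρ) (QTerm.mgu_ne_blank hσ' x)

theorem Interp.SatAtom.of_merge {J : Interp NC NR NI NV} {π : ℕ → J.Dom}
    {g₁ g₂ : QAtom NC NR NI NV} {σ : ℕ → QTerm NI} (hσ : g₁.mgu g₂ = some σ)
    (h : J.SatAtom π ((g₁.subst σ).merge (g₂.subst σ))) :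
    J.SatAtom π (g₁.subst σ) ∧ J.SatAtom π (g₂.subst σ) := by
  cases g₁ with
  | concept A t p =>
    cases g₂ with
    | role => simp [QAtom.mgu] at hσ
    | concept A' t' p' =>
      simp only [QAtom.mgu, Option.ite_none_right_eq_some] at hσ
      obtain ⟨⟨rfl, rfl⟩, hσ⟩ := hσ
      obtain ⟨d, hd, hp⟩ := h
      obtain ⟨h₁, h₂⟩ := hd.of_merge ((QTerm.subst_mgu hσ).imp (QTerm.subst_eq_blank σ)
        (Or.imp_left (QTerm.subst_eq_blank σ)))
      exact ⟨⟨d, h₁, hp⟩, ⟨d, h₂, hp⟩⟩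
  | role R s t p =>
    cases g₂ with
    | concept => simp [QAtom.mgu] at hσ
    | role R' s' t' p' =>
      simp only [QAtom.mgu, Option.ite_none_right_eq_some, Option.bind_eq_some_iff,
        Option.map_eq_some_iff] at hσ
      obtain ⟨⟨rfl, rfl⟩, σ', hσ', ρ, hρ, rfl⟩ := hσ
      obtain ⟨d, e, hd, he, hp⟩ := h
      rw [QTerm.subst_subst, QTerm.subst_subst] at hd he
      obtain ⟨h₁, h₂⟩ := hd.of_merge ((QTerm.subst_mgu hσ').imp
        (fun h => QTerm.subst_eq_blank ρ (QTerm.subst_eq_blank σ' h))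
        (Or.imp (fun h => QTerm.subst_eq_blank ρ (QTerm.subst_eq_blank σ' h))
          (congrArg (QTerm.subst ρ))))
      obtain ⟨h₃, h₄⟩ := he.of_merge ((QTerm.subst_mgu hρ).imp (QTerm.subst_eq_blank ρ)
        (Or.imp_left (QTerm.subst_eq_blank ρ)))
      simp only [QAtom.subst, QTerm.subst_subst]
      exact ⟨⟨d, e, h₁, h₃, hp⟩, ⟨d, e, h₂, h₄, hp⟩⟩

/-- Assign to each variable x the value of σ x in the match of the reduced query; the merged atom
implies the instances of both unified atoms. -/
theorem Interp.SatQuery.of_reduce {J : Interp NC NR NI NV} {q r : BCQ NC NR NI NV}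
    {g₁ g₂ : QAtom NC NR NI NV} (hr : reduce q g₁ g₂ = some r) (h : J.SatQuery r) :
    J.SatQuery q := by
  simp only [reduce, Option.map_eq_some_iff] at hr
  obtain ⟨σ, hσ, rfl⟩ := hr
  obtain ⟨π, h⟩ := h
  have hex : ∀ x, ∃ d, ∀ d', J.Value π (σ x) d' → d' = d := by
    intro x
    have := QAtom.mgu_ne_blank hσ x
    cases hx : σ x with
    | const a => exact ⟨_, fun _ h => h⟩
    | var y => exact ⟨_, fun _ h => h⟩
    | blank => exact absurd hx this
  choose π' hπ' using hex
  refine ⟨π', fun g hg => Interp.SatAtom.of_subst hπ' ?_⟩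
  obtain ⟨h₁, h₂⟩ := Interp.SatAtom.of_merge hσ (h _ (Finset.mem_insert_self _ _))
  by_cases hg₁ : g = g₁
  · exact hg₁ ▸ h₁
  by_cases hg₂ : g = g₂
  · exact hg₂ ▸ h₂
  exact h _ (Finset.mem_insert_of_mem (Finset.mem_image_of_mem _
    (Finset.mem_erase.mpr ⟨hg₂, Finset.mem_erase.mpr ⟨hg₁, hg⟩⟩)))

theorem Mono.sub_mul {p : Multiset NV} {v : Mono NV} (hv : v.1 ≤ p) (hp : p - v.1 ≠ 0) :
    ∃ hp' : p ≠ 0, Mono.mul ⟨p - v.1, hp⟩ v = ⟨p, hp'⟩ := by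
  refine ⟨fun h => hp (by simp [h]), Subtype.ext ?_⟩
  exact tsub_add_cancel_of_le hv

omit [DecidableEq NI] in
-- Atoms with the empty product are never satisfied, so the rewritten atom supplies a genuine
-- monomial p ⊖ v. The inclusion multiplies it by v and gives back p.
theorem Interp.SatAtom.of_gr {J : Interp NC NR NI NV} {I : AnnInclusion NC NR NV}
    (hI : J.SatInclusion I) {g g' : QAtom NC NR NI NV} (h : gr g I = some g') {π : ℕ → J.Dom}
    (hs : J.SatAtom π g') : J.SatAtom π g := by
  obtain ⟨I, v⟩ := I
  simp only [gr, Option.ite_none_right_eq_some] at h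
  obtain ⟨hv, h⟩ := h
  unfold QAtom.rewrite at h
  split at h <;> simp only [Option.ite_none_right_eq_some, Option.some.injEq, reduceCtorEq] at h <;>
    obtain ⟨rfl, rfl⟩ := h <;> simp only [QAtom.ann] at hv hs
  · obtain ⟨d, hd, hp, hm⟩ := hs
    obtain ⟨hp', he⟩ := Mono.sub_mul hv hp
    exact ⟨d, hd, hp', he ▸ hI _ _ hm⟩
  · obtain ⟨d, e, hd, -, hp, hm⟩ := hs
    obtain ⟨hp', he⟩ := Mono.sub_mul hv hp
    exact ⟨d, hd, hp', he ▸ hI _ _ (Interp.mem_conceptExt_ex.mpr ⟨e, hm⟩)⟩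
  · obtain ⟨d, hd, hp, hm⟩ := hs
    obtain ⟨hp', he⟩ := Mono.sub_mul hv hp
    obtain ⟨e, h⟩ := Interp.mem_conceptExt_ex.mp (hI _ _ hm)
    exact ⟨d, e, hd, trivial, hp', he ▸ h⟩
  · obtain ⟨d, e', hd, -, hp, hm⟩ := hs
    obtain ⟨hp', he⟩ := Mono.sub_mul hv hp
    obtain ⟨e, h⟩ := Interp.mem_conceptExt_ex.mp (hI _ _ (Interp.mem_conceptExt_ex.mpr ⟨e', hm⟩))
    exact ⟨d, e, hd, trivial, hp', he ▸ h⟩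
  · obtain ⟨d, e, hd, he', hp, hm⟩ := hs
    obtain ⟨hp', he⟩ := Mono.sub_mul hv hp
    exact ⟨d, e, hd, he', hp', he ▸ hI _ _ _ hm⟩
  · obtain ⟨d, e, hd, he', hp, hm⟩ := hs
    obtain ⟨hp', he⟩ := Mono.sub_mul hv hp
    exact ⟨e, d, he', hd, hp', he ▸ Interp.mem_roleExt_inv.mp (hI _ _ _ hm)⟩
  · obtain ⟨d, e, hd, he', hp, hm⟩ := hs
    obtain ⟨hp', he⟩ := Mono.sub_mul hv hp
    exact ⟨e, d, he', hd, hp', he ▸ hI _ _ _ (Interp.mem_roleExt_inv.mpr hm)⟩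

theorem Interp.SatQuery.of_newQueries {J : Interp NC NR NI NV} {T : Ontology NC NR NV}
    (hT : ∀ I ∈ T, J.SatInclusion I) {q q' : BCQ NC NR NI NV} (h : q' ∈ newQueries T q)
    (hs : J.SatQuery q') : J.SatQuery q := by
  rcases mem_newQueries.mp h with ⟨g, hg, I, hI, g', hg', rfl⟩ | ⟨g₁, h₁, g₂, h₂, r, hr, rfl⟩
  · obtain ⟨π, hπ⟩ := hs
    refine ⟨π, fun k hk => ?_⟩
    by_cases hkg : k = g
    · subst hkg
      exact Interp.SatAtom.of_gr (hT I hI) hg' (hπ _ (Finset.mem_insert_self _ _))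
    · exact hπ _ (Finset.mem_insert_of_mem (Finset.mem_erase.mpr ⟨hkg, hk⟩))
  · exact hs.of_tau.of_reduce hr

end

/-! The canonical model -/

/-- Elements of the canonical model: individual names, and for each element `d` a labelled null
that serves as its `R`-successor with annotation `p`. The element `point` makes sure that there is
one. -/
inductive Elem (NR NI NV : Type) : Type
  | point
  | ind (a : NI)
  | null (d : Elem NR NI NV) (R : NR) (p : Multiset NV)

/-- Used to exclude s = y when R(s,y) hits the fact that introduces a null. -/
theorem Elem.null_ne (d : Elem NR NI NV) (R : NR) (p : Multiset NV) : Elem.null d R p ≠ d := by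
  induction d generalizing R p with
  | point => simp
  | ind a => simp
  | null d R' p' ih =>
    intro h
    injection h with h₁ h₂ h₃
    exact ih R' p' h₁

/-- Annotated facts about elements. -/
inductive Fact (NC NR NI NV : Type) : Type
  | concept (A : NC) (d : Elem NR NI NV) (p : Multiset NV)
  | role (R : NR) (d e : Elem NR NI NV) (p : Multiset NV)

def Fact.ann : Fact NC NR NI NV → Multiset NV
  | .concept _ _ p => p
  | .role _ _ _ p => p

/-- The element occurs in the fact. -/
def Fact.Mem (c : Elem NR NI NV) : Fact NC NR NI NV → Prop
  | .concept _ d _ => d = c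
  | .role _ d e _ => d = c ∨ e = c

def Assertion.toFact : Assertion NC NR NI NV → Fact NC NR NI NV
  | .concept A a p => .concept A (.ind a) p.1
  | .role R a b p => .role R (.ind a) (.ind b) p.1

/-- `Step I v F F'`: the inclusion `I` annotated with `v` derives `F'` from `F`. -/
inductive Step : Inclusion NC NR → Multiset NV → Fact NC NR NI NV → Fact NC NR NI NV → Prop
  | sub (A₁ A d p v) : Step (.concept (.name A₁) (.pos (.name A))) v
      (.concept A₁ d p) (.concept A d (p + v))
  | dom (R A d e p v) : Step (.concept (.ex (.name R)) (.pos (.name A))) v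
      (.role R d e p) (.concept A d (p + v))
  | ex (A R d p v) : Step (.concept (.name A) (.pos (.ex (.name R)))) v
      (.concept A d p) (.role R d (.null d R (p + v)) (p + v))
  | exEx (R₁ R d e p v) : Step (.concept (.ex (.name R₁)) (.pos (.ex (.name R)))) v
      (.role R₁ d e p) (.role R d (.null d R (p + v)) (p + v))
  | role (R₁ R d e p v) : Step (.role (.name R₁) (.pos (.name R))) v
      (.role R₁ d e p) (.role R d e (p + v))
  | roleInv (R₁ R d e p v) : Step (.role (.name R₁) (.pos (.inv R))) v
      (.role R₁ d e p) (.role R e d (p + v))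
  | invRole (R₁ R d e p v) : Step (.role (.inv R₁) (.pos (.name R))) v
      (.role R₁ d e p) (.role R e d (p + v))

/-- The facts derived from the assertions `B` with the inclusions `T`. -/
inductive Chase (T : Ontology NC NR NV) (B : Set (Assertion NC NR NI NV)) :
    Fact NC NR NI NV → Prop
  | base (α) : α ∈ B → Chase T B α.toFact
  | step (I F F') : I ∈ T → Chase T B F → Step I.1 I.2.1 F F' → Chase T B F'

theorem Step.ann_eq {I : Inclusion NC NR} {v : Multiset NV} {F F' : Fact NC NR NI NV}
    (h : Step I v F F') : F'.ann = F.ann + v := by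
  cases h <;> rfl

theorem Assertion.toFact_ann_ne_zero (α : Assertion NC NR NI NV) : α.toFact.ann ≠ 0 := by
  cases α with
  | concept A a p => exact p.2
  | role R a b p => exact p.2

theorem Assertion.not_mem_null (α : Assertion NC NR NI NV) (d : Elem NR NI NV) (R : NR)
    (p : Multiset NV) : ¬ α.toFact.Mem (.null d R p) := by
  cases α <;> simp [Assertion.toFact, Fact.Mem]

theorem Chase.ann_ne_zero {T : Ontology NC NR NV} {B : Set (Assertion NC NR NI NV)}
    {F : Fact NC NR NI NV} (h : Chase T B F) : F.ann ≠ 0 := by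
  induction h with
  | base α _ => exact α.toFact_ann_ne_zero
  | step I F F' _ _ hs ih =>
    rw [hs.ann_eq]
    exact fun h => ih (by simpa using (add_eq_zero.mp h).1)

/-- An element of the result of a step is an element of the premise, or the null that the step
introduces. -/
theorem Step.mem_null {I : Inclusion NC NR} {v : Multiset NV} {F F' : Fact NC NR NI NV}
    (h : Step I v F F') {d : Elem NR NI NV} {R : NR} {p : Multiset NV}
    (hm : F'.Mem (.null d R p)) : F' = .role R d (.null d R p) p ∨ F.Mem (.null d R p) := by
  cases h <;> simp only [Fact.Mem] at hm ⊢
  · exact Or.inr hm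
  · exact Or.inr (Or.inl hm)
  · rcases hm with hm | hm
    · exact Or.inr hm
    · injection hm with h₁ h₂ h₃
      subst h₁ h₂ h₃
      exact Or.inl rfl
  · rcases hm with hm | hm
    · exact Or.inr (Or.inl hm)
    · injection hm with h₁ h₂ h₃
      subst h₁ h₂ h₃
      exact Or.inl rfl
  · exact Or.inr hm
  · exact Or.inr hm.symm
  · exact Or.inr hm.symm

/-- A null records its parent, role and annotation, and so determines the fact that introduces it.
It reaches other facts only through further steps, each multiplying by a nonempty monomial. -/
theorem Chase.eq_or_card_lt {T : Ontology NC NR NV} {B : Set (Assertion NC NR NI NV)}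
    {F : Fact NC NR NI NV} (h : Chase T B F) {d : Elem NR NI NV} {R : NR} {p : Multiset NV}
    (hm : F.Mem (.null d R p)) :
    F = .role R d (.null d R p) p ∨ p.card < F.ann.card := by
  induction h with
  | base α _ => exact absurd hm (α.not_mem_null d R p)
  | step I F F' _ _ hs ih =>
    rcases hs.mem_null hm with h | h
    · exact Or.inl h
    · right
      have hv : 0 < I.2.1.card := Multiset.card_pos.mpr I.2.2
      rw [hs.ann_eq, Multiset.card_add]
      rcases ih h with rfl | h
      · simpa [Fact.ann] using hv
      · omega

/-- The canonical interpretation. -/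
def canonical (T : Ontology NC NR NV) (B : Set (Assertion NC NR NI NV)) :
    Interp NC NR NI NV where
  Dom := Elem NR NI NV
  MDom := Multiset NV
  dom_nonempty := ⟨.point⟩
  mdom_nonempty := ⟨0⟩
  ind := .ind
  mono := Subtype.val
  mono_injective := Subtype.val_injective
  concept A := {t | Chase T B (.concept A t.1 t.2)}
  role R := {t | Chase T B (.role R t.1 t.2.1 t.2.2)}

/-! ### Homomorphisms from the canonical model -/

/-- A map from the elements of the canonical model to the domain of an interpretation. -/
noncomputable def Interp.hom (J : Interp NC NR NI NV) : Elem NR NI NV → J.Dom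
  | .point => J.dom_nonempty.some
  | .ind a => J.ind a
  | .null d R p =>
    open Classical in
    if h : ∃ e, ∃ hp : p ≠ 0, (J.hom d, e, J.mono ⟨p, hp⟩) ∈ J.role R then h.choose
    else J.dom_nonempty.some

/-- The successor is chosen from d, R and p alone, so one choice serves every inclusion that
introduces this null. -/
theorem Interp.hom_null {J : Interp NC NR NI NV} {d : Elem NR NI NV} {R : NR} {p : Mono NV}
    (h : ∃ e, (J.hom d, e, J.mono p) ∈ J.role R) :
    (J.hom d, J.hom (.null d R p.1), J.mono p) ∈ J.role R := by
  have h' : ∃ e, ∃ hp : p.1 ≠ 0, (J.hom d, e, J.mono ⟨p.1, hp⟩) ∈ J.role R :=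
    h.imp fun e he => ⟨p.2, he⟩
  rw [Interp.hom, dif_pos h']
  exact h'.choose_spec.2

/-- Satisfaction of the image of a fact. -/
def Interp.SatFact (J : Interp NC NR NI NV) : Fact NC NR NI NV → Prop
  | .concept A d p => ∃ hp : p ≠ 0, (J.hom d, J.mono ⟨p, hp⟩) ∈ J.concept A
  | .role R d e p => ∃ hp : p ≠ 0, (J.hom d, J.hom e, J.mono ⟨p, hp⟩) ∈ J.role R

theorem Interp.SatAssertion.satFact {J : Interp NC NR NI NV} {α : Assertion NC NR NI NV}
    (h : J.SatAssertion α) : J.SatFact α.toFact := by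
  cases α with
  | concept A a p => exact ⟨p.2, h⟩
  | role R a b p => exact ⟨p.2, h⟩

theorem Step.satFact {J : Interp NC NR NI NV} {I : Inclusion NC NR} {v : Mono NV}
    (hI : J.SatInclusion (I, v)) {F F' : Fact NC NR NI NV} (h : Step I v.1 F F')
    (hF : J.SatFact F) : J.SatFact F' := by
  cases h with
  | sub A₁ A d p =>
    obtain ⟨hp, hF⟩ := hF
    exact ⟨(Mono.mul ⟨p, hp⟩ v).2, hI _ _ hF⟩
  | dom R A d e p =>
    obtain ⟨hp, hF⟩ := hF
    exact ⟨(Mono.mul ⟨p, hp⟩ v).2, hI _ _ (Interp.mem_conceptExt_ex.mpr ⟨_, hF⟩)⟩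
  | ex A R d p =>
    obtain ⟨hp, hF⟩ := hF
    exact ⟨(Mono.mul ⟨p, hp⟩ v).2, Interp.hom_null (p := Mono.mul ⟨p, hp⟩ v)
      (Interp.mem_conceptExt_ex.mp (hI _ _ hF))⟩
  | exEx R₁ R d e p =>
    obtain ⟨hp, hF⟩ := hF
    exact ⟨(Mono.mul ⟨p, hp⟩ v).2, Interp.hom_null (p := Mono.mul ⟨p, hp⟩ v)
      (Interp.mem_conceptExt_ex.mp (hI _ _ (Interp.mem_conceptExt_ex.mpr ⟨_, hF⟩)))⟩
  | role R₁ R d e p =>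
    obtain ⟨hp, hF⟩ := hF
    exact ⟨(Mono.mul ⟨p, hp⟩ v).2, hI _ _ _ hF⟩
  | roleInv R₁ R d e p =>
    obtain ⟨hp, hF⟩ := hF
    exact ⟨(Mono.mul ⟨p, hp⟩ v).2, Interp.mem_roleExt_inv.mp (hI _ _ _ hF)⟩
  | invRole R₁ R d e p =>
    obtain ⟨hp, hF⟩ := hF
    exact ⟨(Mono.mul ⟨p, hp⟩ v).2, hI _ _ _ (Interp.mem_roleExt_inv.mpr hF)⟩

theorem Chase.satFact {J : Interp NC NR NI NV} {T : Ontology NC NR NV}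
    {B : Set (Assertion NC NR NI NV)} (hT : ∀ I ∈ T, J.SatInclusion I)
    (hB : ∀ α ∈ B, J.SatAssertion α) {F : Fact NC NR NI NV} (h : Chase T B F) : J.SatFact F := by
  induction h with
  | base α hα => exact (hB α hα).satFact
  | step I F F' hI _ hs ih => exact hs.satFact (hT I hI) ih

/-! ### The canonical interpretation is a model -/

theorem canonical_satAssertion {T : Ontology NC NR NV} {B : Set (Assertion NC NR NI NV)}
    {α : Assertion NC NR NI NV} (h : α ∈ B) : (canonical T B).SatAssertion α := by
  have := Chase.base (T := T) α h
  cases α <;> exact this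

/-- The positive inclusion forms without a chase rule are exactly those that `InverseNormal` rules
out. -/
theorem canonical_satInclusion_of_positive {T : Ontology NC NR NV}
    {B : Set (Assertion NC NR NI NV)} {I : AnnInclusion NC NR NV} (hI : I ∈ T)
    (hp : I.1.isPositive = true) (hn : I.1.InverseNormal) : (canonical T B).SatInclusion I := by
  have step : ∀ {F F'}, Step I.1 I.2.1 F F' → Chase T B F → Chase T B F' :=
    fun hs h => .step I _ _ hI h hs
  obtain ⟨I, v⟩ := I
  cases I with
  | role S T =>
    cases T with
    | neg S' => simp [Inclusion.isPositive] at hp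
    | pos S' =>
      intro p d e h
      cases S <;> cases S'
      · exact step (.role ..) h
      · exact Interp.mem_roleExt_inv.mpr (step (.roleInv ..) h)
      · exact step (.invRole ..) (Interp.mem_roleExt_inv.mp h)
      · exact hn.elim
  | concept C C' =>
    cases C' with
    | neg S' => simp [Inclusion.isPositive] at hp
    | pos C' =>
      intro p d h
      obtain ⟨h₁, h₂⟩ := hn
      rcases C with A₁ | R₁ | R₁ <;> rcases C' with A | R | R
      · exact step (.sub ..) h
      · exact Interp.mem_conceptExt_ex.mpr ⟨_, step (.ex ..) h⟩
      · exact h₂.elim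
      · obtain ⟨e, h⟩ := Interp.mem_conceptExt_ex.mp h
        exact step (.dom ..) h
      · obtain ⟨e, h⟩ := Interp.mem_conceptExt_ex.mp h
        exact Interp.mem_conceptExt_ex.mpr ⟨_, step (.exEx ..) h⟩
      · exact h₂.elim
      all_goals exact h₁.elim

theorem canonical_roleExt_hom {T : Ontology NC NR NV} {B : Set (Assertion NC NR NI NV)}
    {J : Interp NC NR NI NV} (hJ : ∀ F, Chase T B F → J.SatFact F) {S : Role NR}
    {d e : Elem NR NI NV} {p : Mono NV}
    (h : (d, e, (canonical T B).mono p) ∈ (canonical T B).roleExt S) :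
    (J.hom d, J.hom e, J.mono p) ∈ J.roleExt S := by
  cases S with
  | name R => exact (hJ _ h).2
  | inv R => exact Interp.mem_roleExt_inv.mpr (hJ _ (Interp.mem_roleExt_inv.mp h)).2

theorem canonical_conceptExt_hom {T : Ontology NC NR NV} {B : Set (Assertion NC NR NI NV)}
    {J : Interp NC NR NI NV} (hJ : ∀ F, Chase T B F → J.SatFact F) {C : Concept NC NR}
    {d : Elem NR NI NV} {p : Mono NV}
    (h : (d, (canonical T B).mono p) ∈ (canonical T B).conceptExt C) :
    (J.hom d, J.mono p) ∈ J.conceptExt C := by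
  cases C with
  | name A => exact (hJ _ h).2
  | ex S =>
    obtain ⟨e, h⟩ := Interp.mem_conceptExt_ex.mp h
    exact Interp.mem_conceptExt_ex.mpr ⟨_, canonical_roleExt_hom hJ h⟩

/-- A violation would be carried by `J.hom` to a violation in `J`. This is where completeness needs
a given model. -/
theorem canonical_satInclusion_of_negative {T : Ontology NC NR NV}
    {B : Set (Assertion NC NR NI NV)} {J : Interp NC NR NI NV}
    (hJ : ∀ F, Chase T B F → J.SatFact F) {I : AnnInclusion NC NR NV} (hI : J.SatInclusion I)
    (hp : I.1.isPositive = false) : (canonical T B).SatInclusion I := by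
  obtain ⟨I, v⟩ := I
  cases I with
  | role S T =>
    cases T with
    | pos S' => simp [Inclusion.isPositive] at hp
    | neg S' =>
      intro p d e h h'
      exact hI _ _ _ (canonical_roleExt_hom hJ h) (canonical_roleExt_hom hJ h')
  | concept C C' =>
    cases C' with
    | pos S' => simp [Inclusion.isPositive] at hp
    | neg S' =>
      intro p d h h'
      exact hI _ _ (canonical_conceptExt_hom hJ h) (canonical_conceptExt_hom hJ h')

theorem Spec.Satisfiable.canonical {P : Spec NC NR NV}
    (hinv : ∀ I ∈ P.ontology, I.1.InverseNormal) {D : DataInstance NI NV P.schema}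
    (h : P.Satisfiable D) :
    (canonical P.ontology.positive (virtualAssertions P.mapping D)).SatInstance P D := by
  obtain ⟨J, hJ, hJ'⟩ := h
  refine ⟨fun I hI => ?_, fun α hα => canonical_satAssertion hα⟩
  by_cases hp : I.1.isPositive = true
  · exact canonical_satInclusion_of_positive (Finset.mem_filter.mpr ⟨hI, hp⟩) hp (hinv I hI)
  · exact canonical_satInclusion_of_negative
      (fun F => Chase.satFact (fun I hI => hJ I (Finset.mem_filter.mp hI).1) hJ')
      (hJ I hI) (by simpa using hp)

/-! Completeness -/

/-- `c` is a possible value of a term under the assignment `π` of the variables. -/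
def QTerm.Matches (π : ℕ → Elem NR NI NV) : QTerm NI → Elem NR NI NV → Prop
  | .const a, c => c = .ind a
  | .var x, c => c = π x
  | .blank, _ => True

/-- The atom is mapped to the fact by the assignment `π` of the variables. -/
inductive QAtom.Matches (π : ℕ → Elem NR NI NV) : QAtom NC NR NI NV → Fact NC NR NI NV → Prop
  | concept (A t d p) : t.Matches π d → QAtom.Matches π (.concept A t p) (.concept A d p)
  | role (R s t d e p) : s.Matches π d → t.Matches π e →
      QAtom.Matches π (.role R s t p) (.role R d e p)

theorem QAtom.Matches.ann_eq {π : ℕ → Elem NR NI NV} {g : QAtom NC NR NI NV}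
    {F : Fact NC NR NI NV} (h : g.Matches π F) : g.ann = F.ann := by
  cases h <;> rfl

theorem QTerm.Matches.subst {π : ℕ → Elem NR NI NV} {σ : ℕ → QTerm NI}
    (hσ : ∀ x, (σ x).Matches π (π x)) {t : QTerm NI} {d : Elem NR NI NV} (h : t.Matches π d) :
    (t.subst σ).Matches π d := by
  cases t with
  | const a => exact h
  | blank => trivial
  | var x =>
    have h : d = π x := h
    exact h ▸ hσ x

/-- The condition on σ says that replacing x with σ x is consistent with π. It holds for τ and for
the unifiers used below, so the same π serves during the whole descent. -/
theorem QAtom.Matches.subst {π : ℕ → Elem NR NI NV} {σ : ℕ → QTerm NI}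
    (hσ : ∀ x, (σ x).Matches π (π x)) {g : QAtom NC NR NI NV} {F : Fact NC NR NI NV}
    (h : g.Matches π F) : (g.subst σ).Matches π F := by
  cases h with
  | concept A t d p h => exact .concept _ _ _ _ (h.subst hσ)
  | role R s t d e p h h' => exact .role _ _ _ _ _ _ (h.subst hσ) (h'.subst hσ)

theorem QAtom.Matches.merge {π : ℕ → Elem NR NI NV} {g₁ g₂ : QAtom NC NR NI NV}
    {F : Fact NC NR NI NV} (h₁ : g₁.Matches π F) (h₂ : g₂.Matches π F) :
    (g₁.merge g₂).Matches π F := by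
  have hm : ∀ {s t : QTerm NI} {d}, s.Matches π d → t.Matches π d → (s.merge t).Matches π d := by
    intro s t d hs ht
    rcases QTerm.merge_eq_or s t with h | h <;> rw [h] <;> assumption
  cases h₁ with
  | concept A t d p h =>
    cases h₂ with
    | concept _ t' _ _ h' => exact .concept _ _ _ _ (hm h h')
  | role R s t d e p hs ht =>
    cases h₂ with
    | role _ s' t' _ _ _ hs' ht' => exact .role _ _ _ _ _ _ (hm hs hs') (hm ht ht')

/-- The total degree of the annotations of a query. -/
def BCQ.weight (q : BCQ NC NR NI NV) : ℕ := ∑ g ∈ q, g.ann.card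

theorem QAtom.ann_subst (σ : ℕ → QTerm NI) (g : QAtom NC NR NI NV) :
    (g.subst σ).ann = g.ann := by
  cases g <;> rfl

theorem QAtom.ann_merge (g₁ g₂ : QAtom NC NR NI NV) : (g₁.merge g₂).ann = g₁.ann := by
  cases g₁ <;> cases g₂ <;> rfl

theorem QAtom.merge_self (g : QAtom NC NR NI NV) : g.merge g = g := by
  have h : ∀ t : QTerm NI, t.merge t = t := fun t => by cases t <;> rfl
  cases g <;> simp [QAtom.merge, h]

theorem QAtom.Matches.mem_of_occ {π : ℕ → Elem NR NI NV} {g : QAtom NC NR NI NV}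
    {F : Fact NC NR NI NV} (h : g.Matches π F) {x : ℕ} (hx : 0 < g.occ x) : F.Mem (π x) := by
  have hv : ∀ {t : QTerm NI} {d : Elem NR NI NV}, t.Matches π d → 0 < t.occ x → d = π x := by
    intro t d ht hx
    cases t with
    | const a => simp [QTerm.occ] at hx
    | blank => simp [QTerm.occ] at hx
    | var y =>
      simp only [QTerm.occ] at hx
      split at hx
      · next h => exact h ▸ ht
      · simp at hx
  cases h with
  | concept A t d p h => exact hv h hx
  | role R s t d e p hs ht =>
    simp only [QAtom.occ] at hx
    rcases Nat.eq_zero_or_pos (s.occ x) with h | h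
    · exact Or.inr (hv ht (by omega))
    · exact Or.inl (hv hs h)

section
variable [DecidableEq NC] [DecidableEq NR] [DecidableEq NI] [DecidableEq NV]

theorem BCQ.weight_insert_le (g : QAtom NC NR NI NV) (q : BCQ NC NR NI NV) :
    BCQ.weight (insert g q) ≤ g.ann.card + q.weight := by
  unfold BCQ.weight
  by_cases h : g ∈ q
  · rw [Finset.insert_eq_of_mem h]
    exact Nat.le_add_left _ _
  · rw [Finset.sum_insert h]

theorem BCQ.weight_image_le (q : BCQ NC NR NI NV) (σ : ℕ → QTerm NI) :
    BCQ.weight (q.image (QAtom.subst σ)) ≤ q.weight := by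
  unfold BCQ.weight
  refine (Finset.sum_image_le_of_nonneg fun _ _ => Nat.zero_le _).trans (le_of_eq ?_)
  simp only [QAtom.ann_subst]

theorem BCQ.weight_erase (q : BCQ NC NR NI NV) {g : QAtom NC NR NI NV} (hg : g ∈ q) :
    g.ann.card + BCQ.weight (q.erase g) = q.weight :=
  Finset.add_sum_erase q (fun g => g.ann.card) hg

omit [DecidableEq NR] [DecidableEq NV] in
-- The unifier identifies only terms to which π already gives the common value `d`.
theorem QTerm.Matches.mgu {π : ℕ → Elem NR NI NV} {s t : QTerm NI} {d : Elem NR NI NV}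
    (hs : s.Matches π d) (ht : t.Matches π d) :
    ∃ σ, s.mgu t = some σ ∧ ∀ x, (σ x).Matches π (π x) := by
  cases s with
  | blank => exact ⟨.var, by cases t <;> rfl, fun _ => rfl⟩
  | var x =>
    cases t with
    | blank => exact ⟨.var, rfl, fun _ => rfl⟩
    | var y =>
      refine ⟨_, rfl, fun z => ?_⟩
      split
      · next h => subst h; exact (Eq.symm hs).trans ht
      · rfl
    | const a =>
      refine ⟨_, rfl, fun z => ?_⟩
      split
      · next h => subst h; exact (Eq.symm hs).trans ht
      · rfl
  | const a =>
    cases t with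
    | blank => exact ⟨.var, rfl, fun _ => rfl⟩
    | var y =>
      refine ⟨_, rfl, fun z => ?_⟩
      split
      · next h => subst h; exact (Eq.symm ht).trans hs
      · rfl
    | const b =>
      refine ⟨.var, if_pos ?_, fun _ => rfl⟩
      exact Elem.ind.inj ((Eq.symm hs).trans ht)

theorem QAtom.Matches.mgu {π : ℕ → Elem NR NI NV} {g₁ g₂ : QAtom NC NR NI NV}
    {F : Fact NC NR NI NV} (h₁ : g₁.Matches π F) (h₂ : g₂.Matches π F) :
    ∃ σ, g₁.mgu g₂ = some σ ∧ ∀ x, (σ x).Matches π (π x) := by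
  cases h₁ with
  | concept A t d p h =>
    cases h₂ with
    | concept _ t' _ _ h' =>
      simp only [QAtom.mgu, and_self, if_true]
      exact h.mgu h'
  | role R s t d e p hs ht =>
    cases h₂ with
    | role _ s' t' _ _ _ hs' ht' =>
      obtain ⟨σ, hσ, h⟩ := hs.mgu hs'
      obtain ⟨ρ, hρ, h'⟩ := (ht.subst h).mgu (ht'.subst h)
      exact ⟨fun z => (σ z).subst ρ, by simp [QAtom.mgu, hσ, hρ], fun x => (h x).subst h'⟩

theorem QTerm.mgu_self (t : QTerm NI) : t.mgu t = some .var := by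
  cases t with
  | blank => rfl
  | const a => exact if_pos rfl
  | var x =>
    refine congrArg some (funext fun z => ?_)
    split
    · next h => rw [h]
    · rfl

theorem QAtom.mgu_self (g : QAtom NC NR NI NV) : g.mgu g = some .var := by
  cases g <;> simp [QAtom.mgu, QTerm.mgu_self, QTerm.subst]

/-- Reducing an atom with itself makes τ alone available as a step of the loop. -/
theorem reduce_self {q : BCQ NC NR NI NV} {g : QAtom NC NR NI NV} (hg : g ∈ q) :
    reduce q g g = some q := by
  have hid : (QAtom.subst QTerm.var : QAtom NC NR NI NV → _) = id :=
    funext QAtom.subst_var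
  simp only [reduce, QAtom.mgu_self, Option.map_some, QAtom.subst_var, QAtom.merge_self, hid,
    Finset.image_id, Option.some.injEq]
  rw [Finset.erase_eq_of_notMem (Finset.notMem_erase g q), Finset.insert_erase hg]

/-- The assignment maps every atom of the query to a fact with the property `Φ`. -/
def BCQ.Matches (Φ : Fact NC NR NI NV → Prop) (π : ℕ → Elem NR NI NV)
    (q : BCQ NC NR NI NV) : Prop :=
  ∀ g ∈ q, ∃ F, Φ F ∧ g.Matches π F

theorem BCQ.Matches.tau {Φ : Fact NC NR NI NV → Prop} {π : ℕ → Elem NR NI NV}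
    {q : BCQ NC NR NI NV} (h : q.Matches Φ π) : BCQ.Matches Φ π (tau q) := by
  intro g hg
  obtain ⟨k, hk, rfl⟩ := Finset.mem_image.mp hg
  obtain ⟨F, hF, hm⟩ := h k hk
  refine ⟨F, hF, hm.subst fun x => ?_⟩
  split
  · trivial
  · rfl

/-- Merging two distinct atoms removes one of their nonempty annotations from the weight. -/
theorem BCQ.Matches.reduce {Φ : Fact NC NR NI NV → Prop} {π : ℕ → Elem NR NI NV}
    {q : BCQ NC NR NI NV} (h : q.Matches Φ π) {g₁ g₂ : QAtom NC NR NI NV} (h₁ : g₁ ∈ q)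
    (h₂ : g₂ ∈ q) (hne : g₁ ≠ g₂) {F : Fact NC NR NI NV} (hF : Φ F) (hF₀ : F.ann ≠ 0)
    (hm₁ : g₁.Matches π F) (hm₂ : g₂.Matches π F) :
    ∃ r, ProvOBDA.reduce q g₁ g₂ = some r ∧ BCQ.Matches Φ π r ∧ r.weight < q.weight := by
  obtain ⟨σ, hσ, hπ⟩ := hm₁.mgu hm₂
  refine ⟨_, by rw [ProvOBDA.reduce, hσ]; rfl, fun k hk => ?_, ?_⟩
  · rcases Finset.mem_insert.mp hk with rfl | hk
    · exact ⟨F, hF, (hm₁.subst hπ).merge (hm₂.subst hπ)⟩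
    · obtain ⟨l, hl, rfl⟩ := Finset.mem_image.mp hk
      obtain ⟨F', hF', hm⟩ := h l (Finset.mem_of_mem_erase (Finset.mem_of_mem_erase hl))
      exact ⟨F', hF', hm.subst hπ⟩
  · refine (BCQ.weight_insert_le _ _).trans_lt ?_
    rw [QAtom.ann_merge, QAtom.ann_subst, ← q.weight_erase h₁,
      ← BCQ.weight_erase (q.erase g₁) (Finset.mem_erase.mpr ⟨hne.symm, h₂⟩)]
    have := BCQ.weight_image_le ((q.erase g₁).erase g₂) σ
    have : 0 < g₂.ann.card := by
      rw [hm₂.ann_eq]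
      exact Multiset.card_pos.mpr hF₀
    omega

omit [DecidableEq NI] in
/-- Backward application of a step to an atom. If the step introduces a null, then the atom has to be
of the form `R(s, _)`. -/
theorem Step.exists_gr {I : AnnInclusion NC NR NV} {F F' : Fact NC NR NI NV}
    (h : Step I.1 I.2.1 F F') {π : ℕ → Elem NR NI NV} {g : QAtom NC NR NI NV}
    (hm : g.Matches π F')
    (hg : ∀ R d p, F' = .role R d (.null d R p) p → ∃ s, g = .role R s .blank p) :
    ∃ g', gr g I = some g' ∧ g'.Matches π F := by
  obtain ⟨I, v⟩ := I
  -- The annotation of `g` is that of `F` times v, so v divides it and removing v restores the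
  -- premise's annotation.
  have hle : v.1 ≤ g.ann := by
    rw [hm.ann_eq, h.ann_eq]
    exact Multiset.le_add_left _ _
  have hsub : g.ann - v.1 = F.ann := by
    rw [hm.ann_eq, h.ann_eq, add_tsub_cancel_right]
  simp only [gr, if_pos hle, hsub]
  clear hsub hle
  cases h with
  | sub A₁ A d p =>
    cases hm with
    | concept _ t _ _ ht => exact ⟨_, if_pos rfl, .concept _ _ _ _ ht⟩
  | dom R A d e p =>
    cases hm with
    | concept _ t _ _ ht => exact ⟨_, if_pos rfl, .role _ _ _ _ _ _ ht trivial⟩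
  | ex A R d p =>
    obtain ⟨s, rfl⟩ := hg _ _ _ rfl
    cases hm with
    | role _ _ _ _ _ _ hs _ => exact ⟨_, if_pos rfl, .concept _ _ _ _ hs⟩
  | exEx R₁ R d e p =>
    obtain ⟨s, rfl⟩ := hg _ _ _ rfl
    cases hm with
    | role _ _ _ _ _ _ hs _ => exact ⟨_, if_pos rfl, .role _ _ _ _ _ _ hs trivial⟩
  | role R₁ R d e p =>
    cases hm with
    | role _ s t _ _ _ hs ht =>
      -- `rewrite` matches on whether the second term is a blank, so it reduces only once `t` is
      -- split into cases.
      exact ⟨_, by cases t <;> exact if_pos rfl, .role _ _ _ _ _ _ hs ht⟩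
  | roleInv R₁ R d e p =>
    cases hm with
    | role _ s t _ _ _ hs ht =>
      exact ⟨_, by cases t <;> exact if_pos rfl, .role _ _ _ _ _ _ ht hs⟩
  | invRole R₁ R d e p =>
    cases hm with
    | role _ s t _ _ _ hs ht =>
      exact ⟨_, by cases t <;> exact if_pos rfl, .role _ _ _ _ _ _ ht hs⟩

/-- Replacing an atom that matches the result of a step. -/
theorem BCQ.Matches.exists_gr {T : Ontology NC NR NV} {B : Set (Assertion NC NR NI NV)}
    {π : ℕ → Elem NR NI NV} {q : BCQ NC NR NI NV} (h : q.Matches (Chase T B) π)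
    {g : QAtom NC NR NI NV} (hg : g ∈ q) {F : Fact NC NR NI NV} (hF : Chase T B F)
    (hb : ∀ α ∈ B, F ≠ α.toFact) (hm : g.Matches π F)
    (hn : ∀ R d p, F = .role R d (.null d R p) p → ∃ s, g = .role R s .blank p) :
    ∃ q' ∈ newQueries T q, q'.Matches (Chase T B) π ∧ q'.weight < q.weight := by
  cases hF with
  | base α hα => exact absurd rfl (hb α hα)
  | step I F₀ _ hI hF₀ hs =>
    obtain ⟨g', hg', hm'⟩ := hs.exists_gr hm hn
    refine ⟨_, mem_newQueries.mpr (Or.inl ⟨g, hg, I, hI, g', hg', rfl⟩), fun k hk => ?_, ?_⟩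
    · rcases Finset.mem_insert.mp hk with rfl | hk
      · exact ⟨F₀, hF₀, hm'⟩
      · exact h k (Finset.mem_of_mem_erase hk)
    · refine (BCQ.weight_insert_le _ _).trans_lt ?_
      rw [← q.weight_erase hg, hm.ann_eq, hm'.ann_eq, hs.ann_eq, Multiset.card_add]
      have : 0 < I.2.1.card := Multiset.card_pos.mpr I.2.2
      omega

/-- Either two atoms hit a common fact and are merged, or an atom of maximal degree that matches no
assertion is rewritten backwards, after τ if its fact introduces a null and its second term is a
variable. -/
theorem BCQ.Matches.exists_smaller {T : Ontology NC NR NV} {B : Set (Assertion NC NR NI NV)}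
    {out : Finset (BCQ NC NR NI NV)} (hout : ∀ q ∈ out, newQueries T q ⊆ out)
    {π : ℕ → Elem NR NI NV} {q : BCQ NC NR NI NV} (hq : q ∈ out) (h : q.Matches (Chase T B) π)
    (hb : ¬ q.Matches (fun F => ∃ α ∈ B, F = α.toFact) π) :
    ∃ q' ∈ out, q'.Matches (Chase T B) π ∧ q'.weight < q.weight := by
  classical
  have htau : ∀ r : BCQ NC NR NI NV, (ProvOBDA.tau r).weight ≤ r.weight := fun r =>
    BCQ.weight_image_le r _
  by_cases hinj : ∃ g₁ ∈ q, ∃ g₂ ∈ q, g₁ ≠ g₂ ∧ ∃ F, Chase T B F ∧ g₁.Matches π F ∧ g₂.Matches π F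
  · obtain ⟨g₁, h₁, g₂, h₂, hne, F, hF, hm₁, hm₂⟩ := hinj
    obtain ⟨r, hr, hr', hw⟩ := h.reduce h₁ h₂ hne hF hF.ann_ne_zero hm₁ hm₂
    exact ⟨ProvOBDA.tau r, hout q hq (mem_newQueries.mpr (Or.inr ⟨g₁, h₁, g₂, h₂, r, hr, rfl⟩)), hr'.tau,
      (htau r).trans_lt hw⟩
  have hne : (q.filter fun g => ¬ ∃ α ∈ B, g.Matches π α.toFact).Nonempty := by
    simp only [BCQ.Matches, not_forall] at hb
    obtain ⟨g, hg, hb⟩ := hb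
    refine ⟨g, Finset.mem_filter.mpr ⟨hg, ?_⟩⟩
    rintro ⟨α, hα, hm⟩
    exact hb ⟨_, ⟨α, hα, rfl⟩, hm⟩
  -- Maximality ensures that no other atom uses a null introduced by the fact of `g`.
  obtain ⟨g, hg, hmax⟩ := Finset.exists_max_image _ (fun g => g.ann.card) hne
  obtain ⟨hg, hgb⟩ := Finset.mem_filter.mp hg
  obtain ⟨F, hF, hm⟩ := h g hg
  by_cases hn : ∀ R d p, F = .role R d (.null d R p) p → ∃ s, g = .role R s .blank p
  · obtain ⟨q', hq', h'⟩ := h.exists_gr hg hF (fun α hα he => hgb ⟨α, hα, he ▸ hm⟩) hm hn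
    exact ⟨q', hout q hq hq', h'⟩
  simp only [not_forall] at hn
  obtain ⟨R, d, p, rfl, hn⟩ := hn
  cases hm with
  | role _ s t _ _ _ hs ht =>
  cases t with
  | blank => exact absurd ⟨s, rfl⟩ hn
  | const a => exact Elem.noConfusion rfl rfl rfl (heq_of_eq (show Elem.null d R p = .ind a from ht))
  | var y =>
  have hy : Elem.null d R p = π y := ht
  have hm : (QAtom.role R s (.var y) p : QAtom NC NR NI NV).Matches π (.role R d (.null d R p) p) :=
    .role _ _ _ _ _ _ hs ht
  have hocc : ∑ k ∈ q, k.occ y ≤ 1 := by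
    rw [Finset.sum_eq_single_of_mem _ hg]
    · have : s.occ y = 0 := by
        cases s with
        | const a => rfl
        | blank => rfl
        | var z =>
          refine if_neg ?_
          rintro rfl
          exact Elem.null_ne d R p (hy.trans (Eq.symm hs))
      have hy₁ : (QTerm.var y : QTerm NI).occ y = 1 := if_pos rfl
      exact (congrArg₂ (· + ·) this hy₁).le
    · intro k hk hkg
      by_contra hpos
      obtain ⟨F', hF', hm'⟩ := h k hk
      have hmem : ∀ F'', k.Matches π F'' → F''.Mem (.null d R p) := fun F'' h'' =>
        hy ▸ h''.mem_of_occ (Nat.pos_of_ne_zero hpos)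
      have hle := hmax k (Finset.mem_filter.mpr ⟨hk, fun ⟨α, _, hα⟩ =>
        α.not_mem_null d R p (hmem _ hα)⟩)
      -- A second atom containing `y` would hit the same fact as `g`, against `hinj`, or one of
      -- larger degree, against `hmax`.
      rcases hF'.eq_or_card_lt (hmem _ hm') with rfl | hlt
      · exact hinj ⟨k, hk, _, hg, hkg, _, hF', hm', hm⟩
      · rw [← hm'.ann_eq] at hlt
        exact absurd hle (not_le.mpr hlt)
  -- Since `y` occurs only once, τ makes it a blank and the existential rules become applicable.
  have hq₁ : ProvOBDA.tau q ∈ out :=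
    hout q hq (mem_newQueries.mpr (Or.inr ⟨_, hg, _, hg, q, reduce_self hg, rfl⟩))
  have hg₁ := Finset.mem_image_of_mem
    (QAtom.subst fun x => if (∑ g ∈ q, g.occ x) ≤ 1 then .blank else .var x) hg
  have hm₁ := hm.subst (σ := fun x => if (∑ g ∈ q, g.occ x) ≤ 1 then .blank else .var x)
    fun x => by split <;> trivial
  simp only [QAtom.subst, QTerm.subst, if_pos hocc] at hg₁ hm₁
  have hbase : ∀ α ∈ B, Fact.role R d (.null d R p) p ≠ α.toFact := fun α _ he =>
    α.not_mem_null d R p (he ▸ Or.inr rfl)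
  obtain ⟨q', hq', h', hw⟩ := h.tau.exists_gr hg₁ hF hbase hm₁ (by
    intro R' d' p' he
    injection he with h₁ _ _ h₄
    subst h₁ h₄
    exact ⟨_, rfl⟩)
  exact ⟨q', hout _ hq₁ hq', h', hw.trans_le (htau q)⟩

theorem BCQ.Matches.exists_base {T : Ontology NC NR NV} {B : Set (Assertion NC NR NI NV)}
    {out : Finset (BCQ NC NR NI NV)} (hout : ∀ q ∈ out, newQueries T q ⊆ out)
    {π : ℕ → Elem NR NI NV} {q : BCQ NC NR NI NV} (hq : q ∈ out)
    (h : q.Matches (Chase T B) π) :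
    ∃ q' ∈ out, q'.Matches (fun F => ∃ α ∈ B, F = α.toFact) π := by
  induction hn : q.weight using Nat.strong_induction_on generalizing q with
  | _ n ih =>
    by_cases hb : q.Matches (fun F => ∃ α ∈ B, F = α.toFact) π
    · exact ⟨q, hq, hb⟩
    · obtain ⟨q', hq', h', hw⟩ := h.exists_smaller hout hq hb
      exact ih _ (hn ▸ hw) hq' h' rfl

end

/-! ### Between matches into facts and satisfied queries -/

theorem Interp.SatQuery.matches {T : Ontology NC NR NV} {B : Set (Assertion NC NR NI NV)}
    {q : BCQ NC NR NI NV} (h : (canonical T B).SatQuery q) :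
    ∃ π, q.Matches (Chase T B) π := by
  obtain ⟨π, h⟩ := h
  have hv : ∀ (t : QTerm NI) d, (canonical T B).Value π t d → t.Matches π d := by
    intro t d hd
    cases t <;> exact hd
  refine ⟨π, fun g hg => ?_⟩
  have hs := h g hg
  cases g with
  | concept A t p =>
    obtain ⟨d, hd, hp, hm⟩ := hs
    exact ⟨_, hm, .concept _ _ _ _ (hv _ _ hd)⟩
  | role R s t p =>
    obtain ⟨d, e, hd, he, hp, hm⟩ := hs
    exact ⟨_, hm, .role _ _ _ _ _ _ (hv _ _ hd) (hv _ _ he)⟩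

/-- Compose π with `J.hom`. For facts coming from assertions, `J` need not satisfy the ontology:
`J.hom` is total, and its values on nulls are irrelevant there. -/
theorem BCQ.Matches.satQuery {J : Interp NC NR NI NV} {Φ : Fact NC NR NI NV → Prop}
    (hJ : ∀ F, Φ F → J.SatFact F) {π : ℕ → Elem NR NI NV} {q : BCQ NC NR NI NV}
    (h : q.Matches Φ π) : J.SatQuery q := by
  have hv : ∀ {t : QTerm NI} {d}, t.Matches π d → J.Value (fun x => J.hom (π x)) t (J.hom d) := by
    intro t d hd
    cases t with
    | const a => exact congrArg J.hom hd
    | var x => exact congrArg J.hom hd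
    | blank => trivial
  refine ⟨fun x => J.hom (π x), fun g hg => ?_⟩
  obtain ⟨F, hF, hm⟩ := h g hg
  have hs := hJ F hF
  cases hm with
  | concept A t d p ht => exact ⟨_, hv ht, hs⟩
  | role R s t d e p hs' ht => exact ⟨_, _, hv hs', hv ht, hs⟩

end ProvOBDA

/-! ### The rewriting theorem -/

theorem mainTheorem3 {NC NR NI NV : Type}
    [DecidableEq NC] [DecidableEq NR] [DecidableEq NI] [DecidableEq NV]
    (P : ProvOBDA.Spec NC NR NV)
    (hinv : ∀ I ∈ P.ontology, I.1.InverseNormal)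
    (q : ProvOBDA.BCQ NC NR NI NV)
    (hq : ∀ g ∈ q, g.ann ≠ 0) :
    ∃ PR : Finset (ProvOBDA.BCQ NC NR NI NV),
      ProvOBDA.PerfectRefOutputs q P.ontology.positive PR ∧
      ∀ D : ProvOBDA.DataInstance NI NV P.schema, P.Satisfiable D →
        (P.Entails D q ↔ ∃ q' ∈ PR, P.withoutOntology.Entails D q') := by
  obtain ⟨PR, hPR⟩ := ProvOBDA.exists_perfectRefOutputs q P.ontology.positive
  refine ⟨PR, hPR, fun D hD => ⟨fun h => ?_, ?_⟩⟩
  · obtain ⟨π, hπ⟩ := (h _ (hD.canonical hinv)).matches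
    obtain ⟨q', hq', hm⟩ := hπ.exists_base (fun _ => ProvOBDA.Loop.newQueries_subset hPR)
      (ProvOBDA.Loop.subset hPR (Finset.mem_singleton_self q))
    refine ⟨q', hq', fun J hJ => hm.satQuery ?_⟩
    rintro F ⟨α, hα, rfl⟩
    exact (hJ.2 α hα).satFact
  · rintro ⟨q', hq', h⟩ J hJ
    -- For a fixed model `J` of the full instance, which is also a model without the ontology,
    -- soundness is an invariant of the loop.
    refine ProvOBDA.Loop.invariant hPR (Φ := fun q' => J.SatQuery q' → J.SatQuery q)
      (fun q₁ h₁ q₂ h₂ hs => h₁ (hs.of_newQueries (fun I hI => hJ.1 I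
        (Finset.mem_filter.mp hI).1) h₂)) ?_ q' hq' (h J ⟨?_, hJ.2⟩)
    · intro q₁ h₁
      rw [Finset.mem_singleton.mp h₁]
      exact id
    · intro I hI
      exact absurd hI (Finset.notMem_empty I)
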